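/- Let $F$ be a field with $\operatorname{char}(F)\neq 2$, let $a,b,c\in F^*$, and let $M=F(\sqrt a,\sqrt b,\sqrt c)$ with $[M:F]=8$. Put $K=F(\sqrt a)$. For a field extension $L/E$ let $\operatorname{Br}(L/E)$ be the kernel of the scalar extension map $\operatorname{Br}(E)\to\operatorname{Br}(L)$, and let $\operatorname{Br}_2(L/E)$ be the subgroup of those $x\in\operatorname{Br}(L/E)$ with $x^2=1$. Let $\operatorname{Br}(M/K;F)$ be the subgroup of $\operatorname{Br}(M/K)$ consisting of the classes of central simple $K$-algebras that have a unitary $K/F$-involution, i.e. a ring antiautomorphism $\tau$ with $\tau^2=\mathrm{id}$, $\tau|_K\neq\mathrm{id}$ and $\{x\in K:\tau(x)=x\}=F$. For a finite abelian extension $L/E$ let $\operatorname{Dec}(L/E)\subseteq\operatorname{Br}(E)$ be the subgroup of products of classes of cyclic algebras $(L'/E,\sigma,r)$ with $E\subseteq L'\subseteq L$, $L'/E$ cyclic Galois with generator $\sigma$, and $r\in E^*$; and let $\operatorname{Dec}(M/K;F)\subseteq\operatorname{Br}(K)$ be the subgroup of products of classes of cyclic algebras $(L'/K,\sigma,r)$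 with $K\subseteq L'\subseteq M$, $L'/K$ cyclic Galois with generator $\sigma$, and $r\in F^*$. Then $\operatorname{Dec}(M/F)\subseteq\operatorname{Br}_2(M/F)$, $\operatorname{Dec}(M/K;F)\subseteq\operatorname{Br}(M/K;F)$, $\operatorname{Dec}(M/K)\subseteq\operatorname{Br}(M/K)$, scalar extension from $F$ to $K$ maps $\operatorname{Br}_2(M/F)$ into $\operatorname{Br}(M/K;F)$, and there is an exact sequence $$0\longrightarrow \operatorname{Br}_2(M/F)/\operatorname{Dec}(M/F)\longrightarrow \operatorname{Br}(M/K;F)/\operatorname{Dec}(M/K;F)\longrightarrow \operatorname{Br}(M/K)/\operatorname{Dec}(M/K),$$ where the first map is induced by scalar extension $[A]\mapsto[A\otimes_F K]$ and the second by the inclusion $\operatorname{Br}(M/K;F)\subseteq\operatorname{Br}(M/K)$. -/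

import Mathlib

universe u
open scoped TensorProduct

section Basic

theorem csa_mulLeftRight_surjective (K A : Type*) [Field K] [Ring A] [Algebra K A]
    [Algebra.IsCentral K A] [IsSimpleRing A] [FiniteDimensional K A] :
    Function.Surjective (AlgHom.mulLeftRight K A) := by
  let _ : Module (A ⊗[K] Aᵐᵒᵖ) A := TensorProduct.Algebra.module
  have hsmul : ∀ (t : A ⊗[K] Aᵐᵒᵖ) (x : A), t • x = AlgHom.mulLeftRight K A t x := fun _ _ => rfl
  have hsimple : IsSimpleModule (A ⊗[K] Aᵐᵒᵖ) A := by
    refine { toIsSimpleOrder := { eq_bot_or_eq_top := fun N => ?_ } }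
    let I : TwoSidedIdeal A := .mk' N N.zero_mem N.add_mem N.neg_mem
      (fun {x y} hy => by
        have := N.smul_mem (x ⊗ₜ 1) hy
        simpa [hsmul] using this)
      (fun {x y} hx => by
        have := N.smul_mem (1 ⊗ₜ MulOpposite.op y) hx
        simpa [hsmul] using this)
    have hI : ∀ x, x ∈ I ↔ x ∈ N := fun x => TwoSidedIdeal.mem_mk' ..
    rcases eq_bot_or_eq_top I with h | h
    · left; ext x; rw [← hI, h]; simp [TwoSidedIdeal.mem_bot]
    · right; ext x; rw [← hI, h]; simp [TwoSidedIdeal.mem_top]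
  intro φ
  have hend : ∀ f : Module.End (A ⊗[K] Aᵐᵒᵖ) A, ∃ k : K, ∀ x, f x = k • x := by
    intro f
    have h1 : ∀ a x, f (a * x) = a * f x := fun a x => by
      simpa [hsmul] using f.map_smul (a ⊗ₜ 1) x
    have h2 : ∀ a x, f (x * a) = f x * a := fun a x => by
      simpa [hsmul] using f.map_smul (1 ⊗ₜ MulOpposite.op a) x
    have hc : f 1 ∈ Subalgebra.center K A := by
      rw [Subalgebra.mem_center_iff]
      intro b
      rw [← h1, ← h2]; simp
    obtain ⟨k, hk⟩ := (Algebra.IsCentral.mem_center_iff K).1 hc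
    refine ⟨k, fun x => ?_⟩
    have := h2 x 1
    rw [one_mul, hk] at this
    rw [this, Algebra.smul_def]
  let φ' : Module.End (Module.End (A ⊗[K] Aᵐᵒᵖ) A) A :=
    { toFun := φ
      map_add' := φ.map_add
      map_smul' := fun f x => by
        obtain ⟨k, hk⟩ := hend f
        simp [hk] }
  classical
  let b := Module.finBasis K A
  obtain ⟨r, hr⟩ := jacobson_density φ' (Finset.univ.image b)
  refine ⟨r, b.ext fun i => ?_⟩
  exact (hr (b i) (by simp)).symm

theorem csa_mulLeftRight_bijective (K A : Type*) [Field K] [Ring A] [Algebra K A]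
    [Algebra.IsCentral K A] [IsSimpleRing A] [FiniteDimensional K A] :
    Function.Bijective (AlgHom.mulLeftRight K A) := by
  have hs := csa_mulLeftRight_surjective K A
  refine ⟨?_, hs⟩
  have e : Module.finrank K (A ⊗[K] Aᵐᵒᵖ) = Module.finrank K (Module.End K A) := by
    rw [Module.finrank_tensorProduct, Module.finrank_linearMap,
      (MulOpposite.opLinearEquiv K (M := A)).symm.finrank_eq]
  exact (LinearMap.injective_iff_surjective_of_finrank_eq_finrank
    (f := (AlgHom.mulLeftRight K A).toLinearMap) e).2 hs

theorem isSimpleRing_tensorProduct (K A B : Type*) [Field K] [Ring A] [Algebra K A] [Ring B]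
    [Algebra K B] [IsSimpleRing A] [Algebra.IsCentral K B] [IsSimpleRing B]
    [FiniteDimensional K B] : IsSimpleRing (A ⊗[K] B) := by
  have key : ∀ (I : TwoSidedIdeal (A ⊗[K] B)) (φ : Module.End K B) (x : A ⊗[K] B), x ∈ I →
      φ.lTensor A x ∈ I := by
    intro I φ x hx
    obtain ⟨t, rfl⟩ := csa_mulLeftRight_surjective K B φ
    induction t with
    | zero => simp [I.zero_mem]
    | add s t hs ht =>
      rw [map_add, LinearMap.lTensor_add, LinearMap.add_apply]
      exact I.add_mem hs ht
    | tmul b c =>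
      have : (AlgHom.mulLeftRight K B (b ⊗ₜ c)).lTensor A x =
          (1 ⊗ₜ b) * x * (1 ⊗ₜ c.unop) := by
        clear hx
        induction x with
        | zero => simp
        | add x y hx hy => rw [map_add, hx, hy, mul_add, add_mul]
        | tmul a b' => simp
      rw [this]
      exact I.mul_mem_right _ _ (I.mul_mem_left _ _ hx)
  have : Nontrivial (A ⊗[K] B) :=
    (Algebra.TensorProduct.includeLeft_injective (S := K) (A := A) (B := B)
      (algebraMap K B).injective).nontrivial
  refine ⟨{ eq_bot_or_eq_top := fun I => ?_ }⟩
  by_cases hI : I = ⊥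
  · exact .inl hI
  right
  obtain ⟨x, hxI, hx⟩ : ∃ x ∈ I, x ≠ 0 := by
    by_contra! h
    exact hI (TwoSidedIdeal.ext fun x => ⟨fun hx => h x hx,
      fun hx => by rw [TwoSidedIdeal.mem_bot] at hx; exact hx ▸ I.zero_mem⟩)
  let e := Module.finBasis K B
  let E := Algebra.TensorProduct.basis A e
  obtain ⟨i, hi⟩ : ∃ i, E.repr x i ≠ 0 := by
    by_contra! h
    exact hx (E.repr.injective (by ext i; simpa using h i))
  have h1 := key I ((e.coord i).smulRight 1) x hxI
  have h2 : ((e.coord i).smulRight (1 : B)).lTensor A x = E.repr x i ⊗ₜ 1 := by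
    clear hxI hx hi h1
    induction x with
    | zero => simp
    | add x y hx hy => rw [map_add, hx, hy, map_add, Finsupp.add_apply, TensorProduct.add_tmul]
    | tmul a b =>
      have h : a * algebraMap K A (e.repr b i) = e.repr b i • a := by
        rw [← Algebra.commutes, ← Algebra.smul_def]
      simp [E, h, TensorProduct.smul_tmul']
  rw [h2] at h1
  let J : TwoSidedIdeal A :=
    I.comap (Algebra.TensorProduct.includeLeft : A →ₐ[K] A ⊗[K] B)
  have hJ : E.repr x i ∈ J := by
    rw [TwoSidedIdeal.mem_comap]; exact h1
  have h3 := IsSimpleRing.one_mem_of_ne_zero_mem J hi hJ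
  rw [TwoSidedIdeal.mem_comap, map_one] at h3
  exact (TwoSidedIdeal.one_mem_iff I).1 h3

theorem mem_center_tensorProduct (K A B : Type*) [Field K] [Ring A] [Algebra K A] [Ring B]
    [Algebra K B] [Algebra.IsCentral K B] [Nontrivial B] (x : A ⊗[K] B)
    (hx : x ∈ Subalgebra.center K (A ⊗[K] B)) :
    ∃ a ∈ Subalgebra.center K A, x = a ⊗ₜ 1 := by
  have h1 : x ∈ Subalgebra.centralizer K
      ((Algebra.TensorProduct.includeRight : B →ₐ[K] A ⊗[K] B).range : Set (A ⊗[K] B)) :=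
    fun y _ => (Subalgebra.mem_center_iff.1 hx y)
  rw [Subalgebra.centralizer_range_includeRight_eq_center_tensorProduct] at h1
  obtain ⟨t, rfl⟩ := h1
  have h2 : ∃ a : A, Algebra.TensorProduct.map (AlgHom.id K A) (Subalgebra.center K B).val t
      = a ⊗ₜ 1 := by
    clear hx
    induction t with
    | zero => exact ⟨0, by simp⟩
    | add s t hs ht =>
      obtain ⟨a, ha⟩ := hs
      obtain ⟨b, hb⟩ := ht
      exact ⟨a + b, by rw [map_add, ha, hb, TensorProduct.add_tmul]⟩
    | tmul a c =>
      obtain ⟨k, hk⟩ := (Algebra.IsCentral.mem_center_iff K).1 c.2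
      refine ⟨k • a, ?_⟩
      simp [hk, Algebra.algebraMap_eq_smul_one, TensorProduct.smul_tmul']
  obtain ⟨a, ha⟩ := h2
  refine ⟨a, ?_, ha⟩
  change Algebra.TensorProduct.map (AlgHom.id K A) (Subalgebra.center K B).val t ∈ _ at hx
  rw [ha, Subalgebra.mem_center_iff] at hx
  rw [Subalgebra.mem_center_iff]
  intro b
  have := hx (b ⊗ₜ 1)
  simp only [Algebra.TensorProduct.tmul_mul_tmul, mul_one] at this
  exact Algebra.TensorProduct.includeLeft_injective (S := K) (algebraMap K B).injective this

theorem isCentral_tensorProduct (K A B : Type*) [Field K] [Ring A] [Algebra K A] [Ring B]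
    [Algebra K B] [Algebra.IsCentral K A] [Algebra.IsCentral K B] [Nontrivial B] :
    Algebra.IsCentral K (A ⊗[K] B) where
  out x hx := by
    obtain ⟨a, ha, rfl⟩ := mem_center_tensorProduct K A B x hx
    obtain ⟨k, rfl⟩ := (Algebra.IsCentral.mem_center_iff K).1 ha
    exact ⟨k, rfl⟩

theorem isCentral_baseChange (F K A : Type*) [Field F] [Field K] [Algebra F K] [Ring A]
    [Algebra F A] [Algebra.IsCentral F A] [Nontrivial A] :
    Algebra.IsCentral K (K ⊗[F] A) where
  out x hx := by
    have : x ∈ Subalgebra.center F (K ⊗[F] A) := by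
      rw [Subalgebra.mem_center_iff] at hx ⊢
      exact hx
    obtain ⟨a, -, rfl⟩ := mem_center_tensorProduct F K A x this
    exact ⟨a, rfl⟩

end Basic

namespace BrauerGroup

/-- A finite-dimensional central simple `K`-algebra as an object of `CSA K`. -/
def csaOf (K A : Type u) [Field K] [Ring A] [Algebra K A] [Algebra.IsCentral K A]
    [IsSimpleRing A] [FiniteDimensional K A] : CSA.{u, u} K where
  toAlgCat := AlgCat.of K A

/-- The Brauer class of a finite-dimensional central simple `K`-algebra. -/
def cls {K : Type u} [Field K] (A : CSA.{u, u} K) : BrauerGroup.{u, u} K :=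
  Quotient.mk (Brauer.CSA_Setoid K) A

theorem cls_eq_iff {K : Type u} [Field K] {A B : CSA.{u, u} K} :
    cls A = cls B ↔ IsBrauerEquivalent A B :=
  Quotient.eq (r := Brauer.CSA_Setoid K)

theorem isBrauerEquivalent_of_algEquiv {K : Type u} [Field K] {A B : CSA.{u, u} K}
    (e : A ≃ₐ[K] B) : IsBrauerEquivalent A B :=
  ⟨1, 1, one_ne_zero, one_ne_zero, ⟨e.mapMatrix⟩⟩

theorem cls_eq_of_algEquiv {K : Type u} [Field K] {A B : CSA.{u, u} K} (e : A ≃ₐ[K] B) :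
    cls A = cls B :=
  cls_eq_iff.2 (isBrauerEquivalent_of_algEquiv e)

section Group

variable {K : Type u} [Field K]

/-- The tensor product of two central simple algebras. -/
def tensor (A B : CSA.{u, u} K) : CSA.{u, u} K :=
  haveI := isCentral_tensorProduct K A B
  haveI := isSimpleRing_tensorProduct K A B
  csaOf K (A ⊗[K] B)

/-- The opposite algebra of a central simple algebra. -/
def opp (A : CSA.{u, u} K) : CSA.{u, u} K := csaOf K (Aᵐᵒᵖ)

theorem tensor_congr {A A' B B' : CSA.{u, u} K} (h : IsBrauerEquivalent A A')
    (h' : IsBrauerEquivalent B B') : IsBrauerEquivalent (tensor A B) (tensor A' B') := by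
  obtain ⟨n, m, hn, hm, ⟨e⟩⟩ := h
  obtain ⟨p, q, hp, hq, ⟨f⟩⟩ := h'
  refine ⟨n * p, m * q, mul_ne_zero hn hp, mul_ne_zero hm hq, ⟨?_⟩⟩
  exact ((Matrix.reindexAlgEquiv K (A ⊗[K] B) finProdFinEquiv).symm.trans
    (Matrix.kroneckerTMulAlgEquiv (Fin n) (Fin p) K K A B).symm).trans
    ((Algebra.TensorProduct.congr e f).trans
    ((Matrix.kroneckerTMulAlgEquiv (Fin m) (Fin q) K K A' B').trans
    (Matrix.reindexAlgEquiv K (A' ⊗[K] B') finProdFinEquiv)))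

theorem opp_congr {A B : CSA.{u, u} K} (h : IsBrauerEquivalent A B) :
    IsBrauerEquivalent (opp A) (opp B) := by
  obtain ⟨n, m, hn, hm, ⟨e⟩⟩ := h
  exact ⟨n, m, hn, hm, ⟨(AlgEquiv.mopMatrix (R := K) (α := A)).trans
    (e.op.trans (AlgEquiv.mopMatrix (R := K) (α := B)).symm)⟩⟩

theorem isBrauerEquivalent_one_of_algEquiv {A : CSA.{u, u} K} {n : ℕ} (hn : n ≠ 0)
    (e : A ≃ₐ[K] Matrix (Fin n) (Fin n) K) : IsBrauerEquivalent A (csaOf K K) :=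
  ⟨1, 1 * n, one_ne_zero, mul_ne_zero one_ne_zero hn, ⟨e.mapMatrix.trans
    ((Matrix.compAlgEquiv (Fin 1) (Fin n) K K).trans
      (Matrix.reindexAlgEquiv K K finProdFinEquiv))⟩⟩

theorem opp_tensor (A : CSA.{u, u} K) : IsBrauerEquivalent (tensor (opp A) A) (csaOf K K) := by
  have e : (A : Type u)ᵐᵒᵖ ⊗[K] A ≃ₐ[K]
      Matrix (Fin (Module.finrank K A)) (Fin (Module.finrank K A)) K :=
    ((Algebra.TensorProduct.comm K (A : Type u)ᵐᵒᵖ A).trans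
      (AlgEquiv.ofBijective _ (csa_mulLeftRight_bijective K A))).trans
      (algEquivMatrix (Module.finBasis K A))
  exact isBrauerEquivalent_one_of_algEquiv (A := tensor (opp A) A) Module.finrank_pos.ne' e

/-- The group law on the Brauer group: `[A] * [B] = [A ⊗ B]`, `1 = [K]`, `[A]⁻¹ = [Aᵒᵖ]`. -/
instance instCommGroup : CommGroup (BrauerGroup.{u, u} K) where
  mul := Quotient.map₂ tensor fun _ _ h _ _ h' => tensor_congr h h'
  one := cls (csaOf K K)
  inv := Quotient.map opp fun _ _ h => opp_congr h
  mul_assoc := by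
    rintro ⟨A⟩ ⟨B⟩ ⟨C⟩
    exact cls_eq_of_algEquiv (A := tensor (tensor A B) C) (B := tensor A (tensor B C))
      (Algebra.TensorProduct.assoc K K K A B C)
  one_mul := by
    rintro ⟨A⟩
    exact cls_eq_of_algEquiv (A := tensor (csaOf K K) A) (Algebra.TensorProduct.lid K A)
  mul_one := by
    rintro ⟨A⟩
    exact cls_eq_of_algEquiv (A := tensor A (csaOf K K)) (Algebra.TensorProduct.rid K K A)
  mul_comm := by
    rintro ⟨A⟩ ⟨B⟩
    exact cls_eq_of_algEquiv (A := tensor A B) (B := tensor B A) (Algebra.TensorProduct.comm K A B)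
  inv_mul_cancel := by
    rintro ⟨A⟩
    exact cls_eq_iff.2 (opp_tensor A)

theorem cls_tensor (A B : CSA.{u, u} K) : cls (tensor A B) = cls A * cls B := rfl

theorem cls_opp (A : CSA.{u, u} K) : cls (opp A) = (cls A)⁻¹ := rfl

theorem cls_self : cls (csaOf K K) = 1 := rfl

end Group

section BaseChange

variable (F K : Type u) [Field F] [Field K] [Algebra F K]

/-- Extension of scalars of a central simple algebra. -/
def baseChange (A : CSA.{u, u} F) : CSA.{u, u} K :=
  haveI := isCentral_baseChange F K A
  haveI := isSimpleRing_tensorProduct F K A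
  csaOf K (K ⊗[F] A)

theorem ofId_matrix_one_bijective :
    Function.Bijective (Algebra.ofId K (Matrix (Fin 1) (Fin 1) K)) := by
  refine ⟨(algebraMap K (Matrix (Fin 1) (Fin 1) K)).injective, fun M => ⟨M 0 0, ?_⟩⟩
  ext i j
  rw [Subsingleton.elim i 0, Subsingleton.elim j 0]
  simp [Algebra.ofId_apply, Matrix.algebraMap_matrix_apply]

/-- Matrix algebras commute with extension of scalars. -/
noncomputable def baseChangeMatrix (A : Type u) [Ring A] [Algebra F A] (n : ℕ) :
    K ⊗[F] Matrix (Fin n) (Fin n) A ≃ₐ[K] Matrix (Fin n) (Fin n) (K ⊗[F] A) :=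
  (Algebra.TensorProduct.congr
    (AlgEquiv.ofBijective _ (ofId_matrix_one_bijective K)) AlgEquiv.refl).trans
  ((Matrix.kroneckerTMulAlgEquiv (Fin 1) (Fin n) F K K A).trans
    (Matrix.reindexAlgEquiv K (K ⊗[F] A) (Equiv.uniqueProd (Fin n) (Fin 1))))

theorem baseChange_congr {A B : CSA.{u, u} F} (h : IsBrauerEquivalent A B) :
    IsBrauerEquivalent (baseChange F K A) (baseChange F K B) := by
  obtain ⟨n, m, hn, hm, ⟨e⟩⟩ := h
  exact ⟨n, m, hn, hm, ⟨(baseChangeMatrix F K A n).symm.trans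
    ((Algebra.TensorProduct.congr AlgEquiv.refl e).trans (baseChangeMatrix F K B m))⟩⟩

/-- The restriction (scalar extension) homomorphism `Br(F) → Br(K)`, `[A] ↦ [K ⊗ A]`. -/
def res : BrauerGroup.{u, u} F →* BrauerGroup.{u, u} K where
  toFun := Quotient.map (baseChange F K) fun _ _ h => baseChange_congr F K h
  map_one' := cls_eq_of_algEquiv (A := baseChange F K (csaOf F F)) (B := csaOf K K)
    (Algebra.TensorProduct.rid F K K)
  map_mul' := by
    rintro ⟨A⟩ ⟨B⟩
    exact cls_eq_of_algEquiv (A := baseChange F K (tensor A B))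
      (B := tensor (baseChange F K A) (baseChange F K B))
      (((Algebra.TensorProduct.tensorTensorTensorComm F F K K K A K B).trans
        (Algebra.TensorProduct.congr (Algebra.TensorProduct.lid K K)
          AlgEquiv.refl)).symm)

theorem res_cls (A : CSA.{u, u} F) : res F K (cls A) = cls (baseChange F K A) := rfl

/-- The relative Brauer group `Br(K/F)`, the kernel of `Br(F) → Br(K)`. -/
def relBr : Subgroup (BrauerGroup.{u, u} F) := (res F K).ker

/-- `Br₂(K/F)`, the subgroup of classes in `Br(K/F)` of order dividing `2`. -/
def relBr2 : Subgroup (BrauerGroup.{u, u} F) :=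
  relBr F K ⊓ (powMonoidHom 2 : BrauerGroup.{u, u} F →* BrauerGroup.{u, u} F).ker

end BaseChange

section Unitary

variable (F K : Type u) [Field F] [Field K] [Algebra F K]

/-- A unitary `K/F`-involution on a `K`-algebra `A`: a ring antiautomorphism `τ` with `τ² = id`,
nontrivial on `K`, such that the subfield of `K` fixed by `τ` is `F`. -/
structure IsUnitaryInvolution {A : Type u} [Ring A] [Algebra K A] (τ : A → A) : Prop where
  map_add : ∀ x y, τ (x + y) = τ x + τ y
  map_mul : ∀ x y, τ (x * y) = τ y * τ x
  involutive : Function.Involutive τ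
  nontrivial : ∃ k : K, τ (algebraMap K A k) ≠ algebraMap K A k
  fixed_iff : ∀ k : K, τ (algebraMap K A k) = algebraMap K A k ↔ k ∈ (algebraMap F K).range

variable {F K}

theorem IsUnitaryInvolution.map_one {A : Type u} [Ring A] [Algebra K A] {τ : A → A}
    (h : IsUnitaryInvolution F K τ) : τ 1 = 1 := by
  have h1 := (h.fixed_iff 1).2 ⟨1, by simp⟩
  simpa using h1

theorem exists_gal_ne_one [Algebra.IsQuadraticExtension F K] [IsGalois F K] :
    ∃ ψ : Gal(K/F), ψ ≠ 1 ∧ ∀ φ : Gal(K/F), φ ≠ 1 → φ = ψ := by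
  have hc : Nat.card Gal(K/F) = 2 := by
    rw [IsGalois.card_aut_eq_finrank, Algebra.IsQuadraticExtension.finrank_eq_two]
  obtain ⟨y, hy, huniq⟩ := (Nat.card_eq_two_iff' (1 : Gal(K/F))).1 hc
  exact ⟨y, hy, huniq⟩

theorem gal_fixed_iff [Algebra.IsQuadraticExtension F K] [IsGalois F K] {ψ : Gal(K/F)}
    (hψ : ∀ φ : Gal(K/F), φ ≠ 1 → φ = ψ) (k : K) :
    ψ k = k ↔ k ∈ (algebraMap F K).range := by
  constructor
  · intro h
    change k ∈ Set.range (algebraMap F K)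
    rw [IsGalois.mem_range_algebraMap_iff_fixed]
    intro φ
    by_cases hφ : φ = 1
    · simp [hφ]
    · rw [hψ φ hφ, h]
  · rintro ⟨x, rfl⟩
    exact ψ.commutes x

theorem IsUnitaryInvolution.apply_algebraMap [Algebra.IsQuadraticExtension F K] [IsGalois F K]
    {ψ : Gal(K/F)} (hψ : ∀ φ : Gal(K/F), φ ≠ 1 → φ = ψ)
    {A : CSA.{u, u} K} {τ : A → A} (h : IsUnitaryInvolution F K τ) (k : K) :
    τ (algebraMap K A k) = algebraMap K A (ψ k) := by
  have hc : ∀ k : K, ∃ l : K, τ (algebraMap K A k) = algebraMap K A l := by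
    intro k
    apply (Algebra.IsCentral.mem_center_iff K).1
    rw [Subalgebra.mem_center_iff]
    intro b
    rw [← h.involutive b, ← h.map_mul, ← h.map_mul, Algebra.commutes]
  choose g hg using hc
  have inj : Function.Injective (algebraMap K A) := (algebraMap K A).injective
  let φ : K →ₐ[F] K :=
    { toFun := g
      map_one' := inj (by rw [← hg, _root_.map_one, h.map_one])
      map_mul' := fun x y => inj (by
        rw [← hg, _root_.map_mul, h.map_mul, hg, hg, ← _root_.map_mul, mul_comm])
      map_zero' := inj (by
        rw [← hg, (h.fixed_iff 0).2 ⟨0, by simp⟩])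
      map_add' := fun x y => inj (by
        rw [← hg, _root_.map_add, h.map_add, hg, hg, ← _root_.map_add])
      commutes' := fun x => inj (by
        rw [← hg, (h.fixed_iff _).2 ⟨x, rfl⟩]) }
  let φ' : Gal(K/F) := AlgEquiv.ofBijective φ (Algebra.IsAlgebraic.algHom_bijective φ)
  have hφ : φ' ≠ 1 := by
    intro h1
    obtain ⟨k, hk⟩ := h.nontrivial
    apply hk
    have : g k = k := congr($h1 k)
    rw [hg, this]
  have : g k = ψ k := congr($(hψ φ' hφ) k)
  rw [hg, this]

theorem IsUnitaryInvolution.of_apply_algebraMap [Algebra.IsQuadraticExtension F K] [IsGalois F K]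
    {ψ : Gal(K/F)} (hψ1 : ψ ≠ 1) (hψ : ∀ φ : Gal(K/F), φ ≠ 1 → φ = ψ)
    {A : CSA.{u, u} K} {τ : A → A} (map_add : ∀ x y, τ (x + y) = τ x + τ y)
    (map_mul : ∀ x y, τ (x * y) = τ y * τ x) (involutive : Function.Involutive τ)
    (h : ∀ k : K, τ (algebraMap K A k) = algebraMap K A (ψ k)) :
    IsUnitaryInvolution F K τ where
  map_add := map_add
  map_mul := map_mul
  involutive := involutive
  nontrivial := by
    by_contra! h1
    apply hψ1
    ext k
    have := h1 k
    rw [h] at this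
    exact (algebraMap K A).injective this
  fixed_iff k := by
    rw [h, (algebraMap K A).injective.eq_iff, gal_fixed_iff hψ]

theorem unitary_tensor [Algebra.IsQuadraticExtension F K] [IsGalois F K]
    {A B : CSA.{u, u} K} {τ : A → A} {υ : B → B} (hτ : IsUnitaryInvolution F K τ)
    (hυ : IsUnitaryInvolution F K υ) :
    ∃ ρ : tensor A B → tensor A B, IsUnitaryInvolution F K ρ := by
  obtain ⟨ψ, hψ1, hψ⟩ := exists_gal_ne_one (F := F) (K := K)
  let f : A →ₛₗ[(ψ : K →+* K)] A :=
    { toFun := τ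
      map_add' := hτ.map_add
      map_smul' := fun k a => by
        rw [Algebra.smul_def, hτ.map_mul, hτ.apply_algebraMap hψ, Algebra.smul_def,
          Algebra.commutes]
        rfl }
  let g : B →ₛₗ[(ψ : K →+* K)] B :=
    { toFun := υ
      map_add' := hυ.map_add
      map_smul' := fun k a => by
        rw [Algebra.smul_def, hυ.map_mul, hυ.apply_algebraMap hψ, Algebra.smul_def,
          Algebra.commutes]
        rfl }
  let ρ : A ⊗[K] B →ₛₗ[(ψ : K →+* K)] A ⊗[K] B := TensorProduct.map f g
  have hρ : ∀ a b, ρ (a ⊗ₜ b) = τ a ⊗ₜ υ b := fun _ _ => rfl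
  refine ⟨ρ, .of_apply_algebraMap (A := tensor A B) hψ1 hψ ρ.map_add ?_ ?_ ?_⟩
  · intro x y
    change A ⊗[K] B at x
    change A ⊗[K] B at y
    change ρ (x * y) = ρ y * ρ x
    induction x with
    | zero => simp
    | add x x' hx hx' => rw [add_mul, _root_.map_add, hx, hx', _root_.map_add, mul_add]
    | tmul a b =>
      induction y with
      | zero => simp
      | add y y' hy hy' => rw [mul_add, _root_.map_add, hy, hy', _root_.map_add, add_mul]
      | tmul a' b' =>
        simp only [Algebra.TensorProduct.tmul_mul_tmul, hρ, hτ.map_mul, hυ.map_mul]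
  · intro x
    change A ⊗[K] B at x
    change ρ (ρ x) = x
    induction x with
    | zero => simp
    | add x x' hx hx' => rw [_root_.map_add, _root_.map_add, hx, hx']
    | tmul a b => rw [hρ, hρ, hτ.involutive, hυ.involutive]
  · intro k
    change ρ (algebraMap K A k ⊗ₜ 1) = algebraMap K A (ψ k) ⊗ₜ 1
    rw [hρ, hτ.apply_algebraMap hψ, hυ.map_one]

theorem unitary_opp {A : CSA.{u, u} K} {τ : A → A} (hτ : IsUnitaryInvolution F K τ) :
    ∃ ρ : opp A → opp A, IsUnitaryInvolution F K ρ := by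
  let ρ : (A : Type u)ᵐᵒᵖ → (A : Type u)ᵐᵒᵖ := fun x => MulOpposite.op (τ x.unop)
  have : IsUnitaryInvolution F K ρ :=
    { map_add := fun x y => congr_arg MulOpposite.op (hτ.map_add _ _)
      map_mul := fun x y => congr_arg MulOpposite.op (hτ.map_mul _ _)
      involutive := fun x => congr_arg MulOpposite.op (hτ.involutive _)
      nontrivial := by
        obtain ⟨k, hk⟩ := hτ.nontrivial
        exact ⟨k, fun h => hk (MulOpposite.op_injective h)⟩
      fixed_iff := fun k => by
        rw [← hτ.fixed_iff k]
        exact MulOpposite.op_injective.eq_iff }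
  exact ⟨ρ, this⟩

theorem unitary_self [Algebra.IsQuadraticExtension F K] [IsGalois F K] :
    ∃ ρ : csaOf K K → csaOf K K, IsUnitaryInvolution F K ρ := by
  obtain ⟨ψ, hψ1, hψ⟩ := exists_gal_ne_one (F := F) (K := K)
  have hinv : ∀ x, ψ (ψ x) = x := by
    intro x
    by_cases h : ψ * ψ = 1
    · exact congr($h x)
    · have := hψ _ h
      simp at this
      exact absurd this hψ1
  let ρ : K → K := ψ
  exact ⟨ρ, .of_apply_algebraMap (A := csaOf K K) hψ1 hψ (_root_.map_add ψ)
    (fun x y => (_root_.map_mul ψ (id x : K) (id y : K)).trans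
      (mul_comm (ψ (id x : K)) (ψ (id y : K)))) hinv (fun _ => rfl)⟩

variable (F K)

/-- For a quadratic Galois extension `K/F`, the classes `[A]` in `Br(K)` such that `A` has a
unitary `K/F`-involution. -/
def unitaryBr [Algebra.IsQuadraticExtension F K] [IsGalois F K] :
    Subgroup (BrauerGroup.{u, u} K) where
  carrier := {x | ∃ A : CSA.{u, u} K, cls A = x ∧ ∃ τ : A → A, IsUnitaryInvolution F K τ}
  one_mem' := ⟨csaOf K K, rfl, unitary_self⟩
  mul_mem' := by
    rintro _ _ ⟨A, rfl, τ, hτ⟩ ⟨B, rfl, υ, hυ⟩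
    exact ⟨tensor A B, rfl, unitary_tensor hτ hυ⟩
  inv_mem' := by
    rintro _ ⟨A, rfl, τ, hτ⟩
    exact ⟨opp A, rfl, unitary_opp hτ⟩

/-- `Br(M/K;F)`: the classes in `Br(M/K)` of algebras with a unitary `K/F`-involution. -/
def relUnitaryBr (M : Type u) [Field M] [Algebra K M] [Algebra.IsQuadraticExtension F K]
    [IsGalois F K] : Subgroup (BrauerGroup.{u, u} K) :=
  relBr K M ⊓ unitaryBr F K

end Unitary

section Dec

/-- `A` is (isomorphic to) the cyclic algebra `(L/K, σ, b)`, where `L/K` is cyclic Galois with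
generator `σ`: it contains `L` and an element `z` with `z x = σ(x) z` for `x` in `L` and
`z ^ [L:K] = b`, and `dim A = [L:K]²`; hence `A = ⨁ L zⁱ`, `0 ≤ i < [L:K]`. -/
structure IsCyclicAlgebra (K L : Type u) [Field K] [Field L] [Algebra K L] (σ : Gal(L/K)) (b : K)
    (A : CSA.{u, u} K) : Prop where
  isGalois : IsGalois K L
  generates : ∀ τ : Gal(L/K), τ ∈ Subgroup.zpowers σ
  ne_zero : b ≠ 0
  finrank_eq : Module.finrank K A = Module.finrank K L ^ 2
  exists_pow_eq : ∃ (ι : L →ₐ[K] A) (z : A),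
    z ^ Module.finrank K L = algebraMap K A b ∧ ∀ x : L, z * ι x = ι (σ x) * z

/-- The Brauer classes of the cyclic algebras `(L/K, σ, b)` with `K ⊆ L ⊆ M`, `L` cyclic Galois
over `K`, and `b` a nonzero element of `S`. -/
def cyclicClasses (K M : Type u) [Field K] [Field M] [Algebra K M] (S : Set K) :
    Set (BrauerGroup.{u, u} K) :=
  {x | ∃ (L : IntermediateField K M) (σ : Gal(L/K)) (b : K) (A : CSA.{u, u} K),
    b ∈ S ∧ IsCyclicAlgebra K L σ b A ∧ cls A = x}

/-- `Dec(M/K)` for an abelian extension `M/K`: the subgroup of `Br(K)` of products of classes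
of cyclic algebras `(L/K, σ, b)` with `K ⊆ L ⊆ M` and `b` in `Kˣ`. -/
def Dec (K M : Type u) [Field K] [Field M] [Algebra K M] : Subgroup (BrauerGroup.{u, u} K) :=
  Subgroup.closure (cyclicClasses K M Set.univ)

/-- `Dec(M/K;F)`: the subgroup of `Br(K)` of products of classes of cyclic algebras
`(L/K, σ, b)` with `K ⊆ L ⊆ M` and `b` in `Fˣ`. -/
def DecUnitary (F K M : Type u) [Field F] [Field K] [Field M] [Algebra F K] [Algebra K M] :
    Subgroup (BrauerGroup.{u, u} K) :=
  Subgroup.closure (cyclicClasses K M (Set.range (algebraMap F K)))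

end Dec

end BrauerGroup

/-! All extensions involved are multiquadratic, so a generator of a `Dec` group is trivial or a
quaternion class `(d, r)` with `d` a square in `M` (`eq_one_or_eq_quat_of_mem_cyclicClasses`), and
all such quaternion classes occur (`quat_mem_closure_cyclicClasses`). The working model for a class
split by `M` is an algebra containing `M` as a self-centralizing subfield
(`exists_selfCentralizing`). If the class has exponent two, Skolem–Noether yields an
antiautomorphism fixing `M` pointwise, and for multiquadratic `M` this is automatically an
involution `σ` (`exists_involution_of_algEquiv_op`). Tensoring it with the conjugation `ψ` of `K/F`
shows that restriction lands in the unitary classes.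

Injectivity: `M/K` is generated by the square roots of `b` and `c`, which lie in `F`, so Kummer
theory makes every class of `Dec(M/K;F)` the restriction of a class of `Dec(M/F)`
(`DecUnitary_le_map_Dec`). If the restriction of `x` lies in `Dec(M/K;F)`, then `x` differs from a
class of `Dec(M/F)` by an element of `Br(K/F)`, that is, by a quaternion class `(a, r)`, which is in
`Dec(M/F)` too.

Exactness in the middle rests on two facts. First, `Br₂(M/K) = Dec(M/K)` for biquadratic `M/K`
(`relBr2_le_Dec_of_biquadratic`, `Dec_le_relBr2`): the algebra of degree four splits off a
quaternion subalgebra, and the centralizer is another one. Hence images of exponent-two classes die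
in the third term, and the kernel of the second map comes from unitary classes of exponent two.

Second, every unitary class of exponent two in `Br(M/K)` is the restriction of a class of exponent
two (`exists_res_eq_of_mem_relUnitaryBr`). A unitary involution composed with `σ` gives a
`ψ`-semilinear automorphism, which Skolem–Noether adjusts to some `φ` on `B` extending a lift of `ψ`
to `M`. The defect of `φσφσ` from the identity is an element of `M`; that the unitary involution
squares to the identity makes this element, after scaling, of norm one, and Hilbert 90 removes it.
Then `φ²` is conjugation by an element of `M`, and a twist on `2 × 2` matrices over `B` has order
two. Its fixed ring is the wanted `F`-algebra, and a modified transpose restricts to an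
antiautomorphism of it. -/

/-! ### Skolem–Noether and cancellation of matrix algebras. -/

section Algebras

/-- The inner automorphism of a ring attached to a unit. -/
def innerAut {A : Type*} [Ring A] (w : Aˣ) : A ≃+* A where
  toFun x := w * x * ↑w⁻¹
  invFun x := ↑w⁻¹ * x * w
  left_inv x := by simp [mul_assoc]
  right_inv x := by simp [mul_assoc]
  map_add' x y := by simp [mul_add, add_mul]
  map_mul' x y := by simp [mul_assoc]

theorem innerAut_apply {A : Type*} [Ring A] (w : Aˣ) (x : A) :
    innerAut w x = w * x * ↑w⁻¹ := rfl

/-- Two representations of the same dimension of a finite-dimensional simple algebra are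
isomorphic. -/
theorem exists_intertwiner {K R V W : Type*} [Field K] [Ring R] [Algebra K R] [IsSimpleRing R]
    [FiniteDimensional K R] [AddCommGroup V] [Module K V] [FiniteDimensional K V]
    [AddCommGroup W] [Module K W] [FiniteDimensional K W]
    (ρ : R →ₐ[K] Module.End K V) (ρ' : R →ₐ[K] Module.End K W)
    (h : Module.finrank K V = Module.finrank K W) :
    ∃ θ : V ≃ₗ[K] W, ∀ r v, θ (ρ r v) = ρ' r (θ v) := by
  let _ : Module R V := Module.compHom V ρ.toRingHom
  let _ : Module R W := Module.compHom W ρ'.toRingHom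
  have hV : ∀ (r : R) (v : V), r • v = ρ r v := fun _ _ => rfl
  have hW : ∀ (r : R) (v : W), r • v = ρ' r v := fun _ _ => rfl
  have tV : IsScalarTower K R V := ⟨fun k r v => by simp [hV]⟩
  have tW : IsScalarTower K R W := ⟨fun k r v => by simp [hW]⟩
  have hA : IsArtinianRing R := IsArtinianRing.of_finite K R
  have fV : Module.Finite R V := Module.Finite.of_restrictScalars_finite K R V
  have fW : Module.Finite R W := Module.Finite.of_restrictScalars_finite K R W
  suffices Nonempty (V ≃ₗ[R] W) by
    obtain ⟨e⟩ := this
    exact ⟨e.restrictScalars K, fun r v => e.map_smul r v⟩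
  rcases subsingleton_or_nontrivial V with hs | hn
  · have : Module.finrank K W = 0 := by rw [← h, Module.finrank_zero_of_subsingleton]
    have : Subsingleton W := Module.finrank_zero_iff.1 this
    exact ⟨0, 0, fun x => Subsingleton.elim _ _, fun x => Subsingleton.elim _ _⟩
  · obtain ⟨S, hS⟩ := IsAtomic.exists_atom (Submodule R V)
    rw [← isSimpleModule_iff_isAtom] at hS
    -- `V × W` is isotypic because `R` is simple. Moving `S` into `V × W` lets one simple module `T`
    -- serve for both factors: each is a power of `T`, and the dimension determines the exponent.
    let e := S.equivMapOfInjective (LinearMap.inl R V W) LinearMap.inl_injective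
    have hS' : IsSimpleModule R (S.map (LinearMap.inl R V W)) := .congr e.symm
    have h1 := IsSimpleRing.isIsotypic R (V × W) (S.map (LinearMap.inl R V W))
    have h2 := (h1.of_injective (LinearMap.inl R V W) LinearMap.inl_injective)
    have h3 := (h1.of_injective (LinearMap.inr R V W) LinearMap.inr_injective)
    obtain ⟨n, ⟨e1⟩⟩ := h2.linearEquiv_fun
    obtain ⟨m, ⟨e2⟩⟩ := h3.linearEquiv_fun
    set T := S.map (LinearMap.inl R V W)
    have fT : Module.Finite K T :=
      Module.Finite.of_injective (T.subtype.restrictScalars K) T.subtype_injective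
    have d1 := (e1.restrictScalars K).finrank_eq
    have d2 := (e2.restrictScalars K).finrank_eq
    have : Nontrivial T := IsSimpleModule.nontrivial R T
    have hp : 0 < Module.finrank K T := Module.finrank_pos
    rw [Module.finrank_pi_fintype] at d1 d2
    simp only [Finset.sum_const, Finset.card_univ, Fintype.card_fin, smul_eq_mul] at d1 d2
    have : n = m := by
      rw [d1, d2] at h
      exact Nat.eq_of_mul_eq_mul_right hp h
    subst this
    exact ⟨e1.trans e2.symm⟩

/-- The **Skolem–Noether theorem**. -/
theorem skolem_noether {K S A : Type*} [Field K] [Ring S] [Algebra K S] [IsSimpleRing S]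
    [FiniteDimensional K S] [Ring A] [Algebra K A] [Algebra.IsCentral K A] [IsSimpleRing A]
    [FiniteDimensional K A] (f g : S →ₐ[K] A) :
    ∃ w : Aˣ, ∀ s, g s = w * f s * ↑w⁻¹ := by
  have := isSimpleRing_tensorProduct K S Aᵐᵒᵖ
  -- `S` acts on `A` on the left through `f` or `g`, and `A` acts on the right. An intertwiner
  -- commutes with right multiplications, so it is left multiplication by its value at `1`, the
  -- required unit.
  let ρ (f : S →ₐ[K] A) : S ⊗[K] Aᵐᵒᵖ →ₐ[K] Module.End K A :=
    (AlgHom.mulLeftRight K A).comp (Algebra.TensorProduct.map f (AlgHom.id K _))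
  have hρ : ∀ f s b x, ρ f (s ⊗ₜ b) x = f s * x * b.unop := fun f s b x => by simp [ρ]
  obtain ⟨θ, hθ⟩ := exists_intertwiner (ρ f) (ρ g) rfl
  have h1 : ∀ x b, θ (x * b) = θ x * b := fun x b => by
    simpa [hρ] using hθ (1 ⊗ₜ MulOpposite.op b) x
  have h2 : ∀ s x, θ (f s * x) = g s * θ x := fun s x => by
    simpa [hρ] using hθ (s ⊗ₜ 1) x
  have hinv : θ 1 * θ.symm 1 = 1 := by
    rw [← h1, one_mul, LinearEquiv.apply_symm_apply]
  have hinv' : θ.symm 1 * θ 1 = 1 := by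
    apply θ.injective
    rw [h1, LinearEquiv.apply_symm_apply, one_mul]
  refine ⟨⟨θ 1, θ.symm 1, hinv, hinv'⟩, fun s => ?_⟩
  have h3 : θ 1 * f s = g s * θ 1 := by rw [← h1, ← h2, one_mul, mul_one]
  change g s = θ 1 * f s * θ.symm 1
  rw [h3, mul_assoc, hinv, mul_one]

/-- An isomorphism of matrix rings that preserves the matrix units is entrywise. -/
theorem exists_ringEquiv_of_matrixUnits {n : ℕ} (hn : n ≠ 0) {A B : Type*} [Ring A] [Ring B]
    (θ : Matrix (Fin n) (Fin n) A ≃+* Matrix (Fin n) (Fin n) B)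
    (hθ : ∀ i j, θ (Matrix.single i j 1) = Matrix.single i j 1) :
    ∃ e : A ≃+* B, ∀ X, θ X = X.map e := by
  classical
  let i₀ : Fin n := ⟨0, Nat.pos_of_ne_zero hn⟩
  have hs : ∀ i j a, θ (Matrix.single i j a) =
      Matrix.single i j (θ (Matrix.single i₀ i₀ a) i₀ i₀) := by
    intro i j a
    have h1 : Matrix.single i j a =
        Matrix.single i i₀ 1 * Matrix.single i₀ i₀ a * Matrix.single i₀ j 1 := by simp
    rw [h1, map_mul, map_mul, hθ, hθ]
    rw [Matrix.single_mul_mul_single, one_mul, mul_one]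
  have hs' : ∀ b, θ.symm (Matrix.single i₀ i₀ b) =
      Matrix.single i₀ i₀ (θ.symm (Matrix.single i₀ i₀ b) i₀ i₀) := by
    intro b
    have hθ' : θ.symm (Matrix.single i₀ i₀ 1) = Matrix.single i₀ i₀ 1 := by
      rw [← hθ, RingEquiv.symm_apply_apply]
    have h1 : Matrix.single i₀ i₀ b =
        Matrix.single i₀ i₀ 1 * Matrix.single i₀ i₀ b * Matrix.single i₀ i₀ 1 := by simp
    conv_lhs => rw [h1, map_mul, map_mul, hθ']
    rw [Matrix.single_mul_mul_single, one_mul, mul_one]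
  -- By `hs` the `(i₀, i₀)` corner governs every other entry.
  let e : A ≃+* B :=
    { toFun := fun a => θ (Matrix.single i₀ i₀ a) i₀ i₀
      invFun := fun b => θ.symm (Matrix.single i₀ i₀ b) i₀ i₀
      left_inv := fun a => by
        simp only
        rw [← hs]; simp
      right_inv := fun b => by
        simp only
        rw [← hs']; simp
      map_add' := fun a b => by rw [Matrix.single_add, map_add]; rfl
      map_mul' := fun a b => by
        have : Matrix.single i₀ i₀ (a * b) = Matrix.single i₀ i₀ a * Matrix.single i₀ i₀ b := by
          simp
        rw [this, map_mul, hs i₀ i₀ a, hs i₀ i₀ b]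
        simp }
  refine ⟨e, fun X => ?_⟩
  conv_lhs => rw [Matrix.matrix_eq_sum_single X]
  rw [map_sum, Matrix.matrix_eq_sum_single (X.map e)]
  refine Finset.sum_congr rfl fun i _ => ?_
  rw [map_sum]
  refine Finset.sum_congr rfl fun j _ => ?_
  rw [hs]
  rfl

/-- If matrix algebras of the same positive size over two algebras are isomorphic and central
simple, then so are the algebras. -/
theorem nonempty_algEquiv_of_matrix {K A B : Type*} [Field K] [Ring A] [Algebra K A] [Ring B]
    [Algebra K B] [Algebra.IsCentral K A] [IsSimpleRing A]
    [FiniteDimensional K A] {n : ℕ} (hn : n ≠ 0)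
    (e : Matrix (Fin n) (Fin n) B ≃ₐ[K] Matrix (Fin n) (Fin n) A) : Nonempty (B ≃ₐ[K] A) := by
  classical
  have : Nonempty (Fin n) := ⟨⟨0, Nat.pos_of_ne_zero hn⟩⟩
  -- The scalar matrix algebra over `K` embeds in matrices over `A` directly and through `e`.
  -- Conjugating one embedding into the other makes the isomorphism preserve matrix units.
  obtain ⟨w, hw⟩ := skolem_noether
    (e.toAlgHom.comp (Algebra.ofId K B).mapMatrix) ((Algebra.ofId K A).mapMatrix (m := Fin n))
  let θ : Matrix (Fin n) (Fin n) B ≃+* Matrix (Fin n) (Fin n) A :=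
    e.toRingEquiv.trans (innerAut w)
  have h1 : ∀ Y : Matrix (Fin n) (Fin n) K, θ (Y.map (algebraMap K B)) = Y.map (algebraMap K A) :=
    fun Y => (hw Y).symm
  obtain ⟨f, hf⟩ := exists_ringEquiv_of_matrixUnits hn θ fun i j => by
    have := h1 (Matrix.single i j 1)
    rwa [Matrix.map_single, map_one, Matrix.map_single, map_one] at this
  refine ⟨AlgEquiv.ofRingEquiv (f := f) fun k => ?_⟩
  have h2 := h1 (Matrix.scalar (Fin n) k)
  rw [hf] at h2
  have h3 := congr_fun (congr_fun h2 ⟨0, Nat.pos_of_ne_zero hn⟩) ⟨0, Nat.pos_of_ne_zero hn⟩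
  simpa using h3

end Algebras

/-! ### Centralizers of central simple subalgebras. -/

section Centralizer

/-- A tensor factor of a simple algebra is simple. -/
theorem isSimpleRing_of_tensorProduct_right (K A B : Type*) [Field K] [Ring A] [Algebra K A]
    [Ring B] [Algebra K B] [IsSimpleRing (A ⊗[K] B)] : IsSimpleRing B := by
  have hAB : Nontrivial (A ⊗[K] B) := inferInstance
  have hA : Nontrivial A := by
    by_contra h
    rw [not_nontrivial_iff_subsingleton] at h
    exact not_subsingleton (A ⊗[K] B) inferInstance
  have hB : Nontrivial B := by
    by_contra h
    rw [not_nontrivial_iff_subsingleton] at h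
    exact not_subsingleton (A ⊗[K] B) inferInstance
  refine ⟨{ eq_bot_or_eq_top := fun I => ?_ }⟩
  by_cases hI : I = ⊤
  · exact .inr hI
  left
  let q : B →ₐ[K] I.ringCon.Quotient :=
    { I.ringCon.mk' with commutes' := fun _ => rfl }
  have hq : ∀ x, q x = 0 ↔ x ∈ I := fun x => by
    rw [TwoSidedIdeal.mem_iff]
    exact RingCon.eq I.ringCon
  have : Nontrivial I.ringCon.Quotient := by
    refine ⟨1, 0, fun h => hI ?_⟩
    rw [← TwoSidedIdeal.one_mem_iff, ← hq, map_one, h]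
  -- A homomorphism from the simple ring `A ⊗ B` to a nontrivial ring is injective, so passing to
  -- the quotient by `I` kills nothing.
  have h1 : Function.Injective (Algebra.TensorProduct.map (AlgHom.id K A) q) :=
    RingHom.injective (Algebra.TensorProduct.map (AlgHom.id K A) q).toRingHom
  have h2 : Function.Injective (Algebra.TensorProduct.includeRight : B →ₐ[K] A ⊗[K] B) :=
    Algebra.TensorProduct.includeRight_injective (algebraMap K A).injective
  refine TwoSidedIdeal.ext fun x => ?_
  rw [TwoSidedIdeal.mem_bot, ← hq]
  refine ⟨fun h => h2 (h1 ?_), fun h => by rw [h, map_zero]⟩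
  simp [h]

section

variable {K A E : Type u} [Field K] [Ring A] [Algebra K A] [Ring E] [Algebra K E] (f : A →ₐ[K] E)

/-- Multiplication `A ⊗ C_E(A) → E`. -/
noncomputable def mulCentralizer :
    A ⊗[K] Subalgebra.centralizer K (f.range : Set E) →ₐ[K] E :=
  Algebra.TensorProduct.lift f (Subalgebra.val _) fun a c =>
    (c.2 (f a) ⟨a, rfl⟩)

theorem mulCentralizer_tmul (a : A) (c : Subalgebra.centralizer K (f.range : Set E)) :
    mulCentralizer f (a ⊗ₜ c) = f a * c := by
  exact Algebra.TensorProduct.lift_tmul ..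

variable [Algebra.IsCentral K A] [IsSimpleRing A] [FiniteDimensional K A]

/-- The **double centralizer theorem** for a central simple subalgebra. -/
theorem mulCentralizer_bijective : Function.Bijective (mulCentralizer f) := by
  classical
  let act : A ⊗[K] Aᵐᵒᵖ →ₐ[K] Module.End K E :=
    (AlgHom.mulLeftRight K E).comp (Algebra.TensorProduct.map f f.op)
  have hact : ∀ a b x, act (a ⊗ₜ b) x = f a * x * f b.unop := fun a b x => by simp [act]
  have hinj := (csa_mulLeftRight_bijective K A).1
  let e := Module.finBasis K A
  -- `t i` acts on `A` as the `i`-th coordinate, with scalar values. Acting on `E` it therefore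
  -- lands in the centralizer, and the expansion of an element of `A` in the basis becomes `x = ∑ eᵢ
  -- (tᵢ x)` on `E`. This gives surjectivity; applying `t j` to `∑ eᵢ cᵢ` recovers `c j`, which
  -- gives injectivity.
  choose t ht using fun i => csa_mulLeftRight_surjective K A ((e.coord i).smulRight (1 : A))
  have hc : ∀ i x, act (t i) x ∈ Subalgebra.centralizer K (f.range : Set E) := by
    rintro i x _ ⟨a, rfl⟩
    have h1 : (a ⊗ₜ 1) * t i = (1 ⊗ₜ MulOpposite.op a) * t i := by
      apply hinj
      rw [map_mul, map_mul, ht]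
      ext y
      simp
    have h2 := congr(act $h1 x)
    rw [map_mul, map_mul, Module.End.mul_apply, Module.End.mul_apply, hact, hact] at h2
    simpa using h2
  have hsum : ∀ x, ∑ i, f (e i) * act (t i) x = x := by
    intro x
    have h1 : ∑ i, (e i ⊗ₜ 1) * t i = 1 := by
      apply hinj
      rw [map_sum, map_one]
      ext y
      simp only [map_mul, ht, LinearMap.sum_apply, Module.End.mul_apply]
      simp
    have h2 := congr(act $h1 x)
    rw [map_sum, map_one, LinearMap.sum_apply] at h2
    simpa [hact] using h2
  have hcomm : ∀ (s : A ⊗[K] Aᵐᵒᵖ) (x : E) (c : Subalgebra.centralizer K (f.range : Set E)),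
      act s (x * c) = act s x * c := by
    intro s x c
    induction s with
    | zero => simp
    | add s s' h h' => rw [map_add, LinearMap.add_apply, h, h', LinearMap.add_apply, add_mul]
    | tmul a b =>
      rw [hact, hact, mul_assoc _ (f b.unop), c.2 (f b.unop) ⟨_, rfl⟩]
      simp only [mul_assoc]
  have hf : ∀ (s : A ⊗[K] Aᵐᵒᵖ) (a : A), act s (f a) = f (AlgHom.mulLeftRight K A s a) := by
    intro s a
    induction s with
    | zero => simp
    | add s s' h h' => simp [h, h']
    | tmul a b => simp [hact]
  constructor
  · rw [injective_iff_map_eq_zero]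
    intro x hx
    obtain ⟨c, rfl⟩ : ∃ c : _ → Subalgebra.centralizer K (f.range : Set E),
        x = ∑ i, e i ⊗ₜ c i := by
      clear hx
      induction x with
      | zero => exact ⟨0, by simp⟩
      | add x y hx hy =>
        obtain ⟨c, rfl⟩ := hx
        obtain ⟨d, rfl⟩ := hy
        exact ⟨c + d, by simp [TensorProduct.tmul_add, Finset.sum_add_distrib]⟩
      | tmul a b =>
        refine ⟨fun i => e.repr a i • b, ?_⟩
        simp_rw [← TensorProduct.smul_tmul, ← TensorProduct.sum_tmul, e.sum_repr]
    rw [map_sum] at hx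
    simp_rw [mulCentralizer_tmul] at hx
    have h0 : ∀ j, c j = 0 := by
      intro j
      have h1 := congr(act (t j) $hx)
      rw [map_sum, map_zero] at h1
      simp_rw [hcomm, hf, ht] at h1
      simp [Finsupp.single_apply] at h1
      exact h1
    simp [h0]
  · intro x
    refine ⟨∑ i, e i ⊗ₜ ⟨act (t i) x, hc i x⟩, ?_⟩
    rw [map_sum]
    simp_rw [mulCentralizer_tmul]
    exact hsum x

theorem isSimpleRing_centralizer [IsSimpleRing E] :
    IsSimpleRing (Subalgebra.centralizer K (f.range : Set E)) := by
  have : IsSimpleRing (A ⊗[K] Subalgebra.centralizer K (f.range : Set E)) :=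
    .of_ringEquiv (AlgEquiv.ofBijective _ (mulCentralizer_bijective f)).symm.toRingEquiv ‹_›
  exact isSimpleRing_of_tensorProduct_right K A _

theorem isCentral_centralizer [Algebra.IsCentral K E] [Nontrivial E] :
    Algebra.IsCentral K (Subalgebra.centralizer K (f.range : Set E)) := by
  have : Algebra.IsCentral K (A ⊗[K] Subalgebra.centralizer K (f.range : Set E)) :=
    Algebra.IsCentral.of_algEquiv K _ _ (AlgEquiv.ofBijective _ (mulCentralizer_bijective f)).symm
  exact Algebra.IsCentral.right_of_tensor_of_field K A _

theorem finrank_mul_finrank_centralizer :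
    Module.finrank K A * Module.finrank K (Subalgebra.centralizer K (f.range : Set E)) =
      Module.finrank K E := by
  rw [← Module.finrank_tensorProduct]
  exact (AlgEquiv.ofBijective _ (mulCentralizer_bijective f)).toLinearEquiv.finrank_eq

end

end Centralizer

/-! ### Representing split classes by algebras with a self-centralizing subfield. -/

namespace BrauerGroup

/-- Equal dimensions force the two matrix sizes in a Brauer equivalence to agree, and then the
matrices cancel. -/
theorem nonempty_algEquiv_of_cls_eq {K : Type u} [Field K] {A B : CSA.{u, u} K}
    (h : cls A = cls B) (hd : Module.finrank K A = Module.finrank K B) :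
    Nonempty (A ≃ₐ[K] B) := by
  obtain ⟨n, m, hn, hm, ⟨e⟩⟩ := cls_eq_iff.1 h
  have h1 := e.toLinearEquiv.finrank_eq
  rw [Module.finrank_matrix, Module.finrank_matrix, hd] at h1
  have h2 : 0 < Module.finrank K B := Module.finrank_pos
  have h3 : n = m := by
    have := Nat.eq_of_mul_eq_mul_right h2 h1
    simpa [Nat.mul_self_inj] using this
  subst h3
  exact nonempty_algEquiv_of_matrix hn e

theorem cls_matrix {K : Type u} [Field K] (A : CSA.{u, u} K) (n : ℕ) [Nonempty (Fin n)] :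
    cls (csaOf K (Matrix (Fin n) (Fin n) A)) = cls A := by
  have hn : n ≠ 0 := by
    rintro rfl
    exact IsEmpty.false (Classical.arbitrary (Fin 0))
  refine cls_eq_iff.2 ⟨1, 1 * n, one_ne_zero, mul_ne_zero one_ne_zero hn, ⟨?_⟩⟩
  exact (Matrix.compAlgEquiv (Fin 1) (Fin n) A K).trans
      (Matrix.reindexAlgEquiv K A finProdFinEquiv)

theorem eq_scalar_of_commute_single {n : Type*} [Fintype n] [DecidableEq n] [Nonempty n]
    {R : Type*} [Ring R] (X : Matrix n n R)
    (h : ∀ i j, X * Matrix.single i j 1 = Matrix.single i j 1 * X) :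
    ∃ r, X = Matrix.scalar n r := by
  have h' := Matrix.mem_range_scalar_of_commute_single (M := X) fun i j _ => (h i j).symm
  obtain ⟨r, hr⟩ := h'
  exact ⟨r, hr.symm⟩

/-- A splitting over `M` embeds a matrix algebra `A` over the given algebra in `q × q` matrices over
`M`, hence in the split algebra `E` of matrices over `End_F M`. The centralizer `C` of `A` in `E`
has the inverse class and contains `M` as scalar matrices, so its opposite is the required algebra.
The dimension comes from `dim A = q²` and `dim E = q² [M:F]²`. -/
theorem exists_selfCentralizing {F M : Type u} [Field F] [Field M] [Algebra F M]
    [FiniteDimensional F M] {x : BrauerGroup.{u, u} F} (hx : x ∈ relBr F M) :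
    ∃ (B : CSA.{u, u} F) (ι : M →ₐ[F] B), cls B = x ∧
      Module.finrank F B = Module.finrank F M ^ 2 ∧
      ∀ b, (∀ m, b * ι m = ι m * b) → ∃ m, b = ι m := by
  classical
  obtain ⟨A₀, rfl⟩ := Quotient.exists_rep x
  change res F M (cls A₀) = 1 at hx
  rw [res_cls, ← cls_self, cls_eq_iff] at hx
  obtain ⟨p, q, hp, hq, ⟨e⟩⟩ := hx
  have : Nonempty (Fin p) := ⟨⟨0, Nat.pos_of_ne_zero hp⟩⟩
  have : Nonempty (Fin q) := ⟨⟨0, Nat.pos_of_ne_zero hq⟩⟩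
  change Matrix (Fin p) (Fin p) (M ⊗[F] A₀) ≃ₐ[M] Matrix (Fin q) (Fin q) M at e
  let A := Matrix (Fin p) (Fin p) A₀
  let e' : M ⊗[F] A ≃ₐ[M] Matrix (Fin q) (Fin q) M := (baseChangeMatrix F M A₀ p).trans e
  let E := Matrix (Fin q) (Fin q) (Module.End F M)
  let em := algEquivMatrix (Module.finBasis F M)
  have : Nonempty (Fin (Module.finrank F M)) := ⟨⟨0, Module.finrank_pos⟩⟩
  have s1 : IsSimpleRing (Module.End F M) := .of_ringEquiv em.symm.toRingEquiv inferInstance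
  have s2 : Algebra.IsCentral F (Module.End F M) := inferInstance
  have s3 : Algebra.IsCentral F E := inferInstance
  have s4 : IsSimpleRing E := inferInstance
  let g : Matrix (Fin q) (Fin q) M →ₐ[F] E := (Algebra.lmul F M).mapMatrix
  have hg : ∀ X, g X = X.map (Algebra.lmul F M) := fun _ => rfl
  let f : A →ₐ[F] E := (g.comp (e'.toAlgHom.restrictScalars F)).comp
    Algebra.TensorProduct.includeRight
  have hf : ∀ a, f a = g (e' (1 ⊗ₜ a)) := fun _ => rfl
  have c1 := isSimpleRing_centralizer f
  have c2 := isCentral_centralizer f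
  have c3 := finrank_mul_finrank_centralizer f
  have c4 := mulCentralizer_bijective f
  let C := Subalgebra.centralizer F (f.range : Set E)
  let ιE : M →ₐ[F] E := (Matrix.scalarAlgHom (Fin q) F).comp (Algebra.lmul F M)
  have hιE : ∀ m, ιE m = g (Matrix.scalar (Fin q) m) := fun m => by
    rw [hg, Matrix.scalar_apply, Matrix.diagonal_map (map_zero _)]
    rfl
  have hcomm : ∀ m a, ιE m * f a = f a * ιE m := by
    intro m a
    rw [hιE, hf, ← map_mul, ← map_mul]
    congr 1
    exact (Matrix.scalar_commute m (fun _ => Commute.all _ _) _)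
  let ιC : M →ₐ[F] C := ιE.codRestrict C (by rintro m _ ⟨a, rfl⟩; exact (hcomm m a).symm)
  refine ⟨opp (csaOf F C), ιC.toOpposite fun x y => by
    rw [Commute, SemiconjBy, ← map_mul, ← map_mul, mul_comm], ?_, ?_, ?_⟩
  · have h1 : cls (tensor (csaOf F A) (csaOf F C)) = cls (csaOf F E) :=
      cls_eq_of_algEquiv (A := tensor (csaOf F A) (csaOf F C)) (B := csaOf F E)
        (AlgEquiv.ofBijective _ c4)
    have h2 : cls (csaOf F E) = 1 :=
      cls_eq_iff.2 (isBrauerEquivalent_one_of_algEquiv (A := csaOf F E)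
        (n := q * Module.finrank F M) (mul_ne_zero hq Module.finrank_pos.ne')
        (em.mapMatrix.trans ((Matrix.compAlgEquiv (Fin q) (Fin (Module.finrank F M)) F F).trans
          (Matrix.reindexAlgEquiv F F finProdFinEquiv))))
    rw [cls_tensor, h2, cls_matrix] at h1
    rw [cls_opp, inv_eq_of_mul_eq_one_left h1]
    rfl
  · have h1 : Module.finrank F A = q * q := by
      rw [← Module.finrank_baseChange (R := M), e'.toLinearEquiv.finrank_eq, Module.finrank_matrix]
      simp
    have h2 : Module.finrank F E = q * q * Module.finrank F M ^ 2 := by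
      rw [Module.finrank_matrix, Module.finrank_linearMap, sq]
      simp
    rw [h1, h2] at c3
    have h3 := Nat.eq_of_mul_eq_mul_left (Nat.mul_pos (Nat.pos_of_ne_zero hq)
      (Nat.pos_of_ne_zero hq)) c3
    rw [← h3]
    exact (MulOpposite.opLinearEquiv F (M := C)).symm.finrank_eq
  · intro b hb
    change Cᵐᵒᵖ at b
    obtain ⟨b⟩ := b
    have hb1 : ∀ m, (b : E) * ιE m = ιE m * b := fun m => by
      have := congr_arg (fun z : Cᵐᵒᵖ => (z.unop : E)) (hb m)
      exact this.symm
    -- `A` and the scalars `M` together span the matrices over `M`. Commuting with matrix units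
    -- makes `b` a scalar matrix with entry in `End_F M`; commuting with `M` makes that entry
    -- multiplication by its value at `1`.
    have hb2 : ∀ X, (b : E) * g X = g X * b := by
      intro X
      obtain ⟨t, rfl⟩ := e'.surjective X
      induction t with
      | zero => simp
      | add s t hs ht => rw [map_add, map_add, mul_add, add_mul, hs, ht]
      | tmul m a =>
        have : e' (m ⊗ₜ a) = Matrix.scalar (Fin q) m * e' (1 ⊗ₜ a) := by
          have h1 : (m ⊗ₜ a : M ⊗[F] A) = m • (1 ⊗ₜ a) := by
            rw [TensorProduct.smul_tmul', smul_eq_mul, mul_one]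
          rw [h1, map_smul, Algebra.smul_def]
          rfl
        rw [this, map_mul, ← hιE, ← hf, ← mul_assoc, hb1, mul_assoc, ← b.2 (f a) ⟨a, rfl⟩,
          mul_assoc]
    obtain ⟨r, hr⟩ := eq_scalar_of_commute_single (b : E) fun i j => by
      have := hb2 (Matrix.single i j 1)
      rwa [hg, Matrix.map_single, map_one] at this
    have hr2 : ∀ m y, r (m * y) = m * r y := by
      intro m y
      have h1 := hb1 m
      rw [hr] at h1
      change Matrix.scalar (Fin q) r * Matrix.scalar (Fin q) (Algebra.lmul F M m) =
        Matrix.scalar (Fin q) (Algebra.lmul F M m) * Matrix.scalar (Fin q) r at h1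
      rw [← map_mul, ← map_mul, Matrix.scalar_inj] at h1
      exact congr($h1 y)
    refine ⟨r 1, MulOpposite.unop_injective (Subtype.ext ?_)⟩
    change (b : E) = ιE (r 1)
    rw [hr]
    change Matrix.scalar (Fin q) r = Matrix.scalar (Fin q) (Algebra.lmul F M (r 1))
    congr 1
    ext y
    have := hr2 y 1
    simpa [mul_comm] using this

end BrauerGroup

/-! ### Quaternion algebras and their classes. -/

namespace BrauerGroup

section Quaternion

open Quaternion

variable {K : Type u} [Field K]

/-- Adding to `x` its conjugate by `i`, and then to the sum its conjugate by `j`, leaves four times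
the real part. An ideal with an element of nonzero real part is thus everything; in any other ideal,
multiplying by `1, i, j, k` shows all coordinates vanish. -/
theorem isSimpleRing_quaternionAlgebra (h2 : (2 : K) ≠ 0) {d r : K} (hd : d ≠ 0) (hr : r ≠ 0) :
    IsSimpleRing ℍ[K,d,0,r] := by
  have h4 : (4 : K) ≠ 0 := by
    have : (4 : K) = 2 * 2 := by norm_num
    rw [this]
    exact mul_ne_zero h2 h2
  have key : ∀ (I : TwoSidedIdeal ℍ[K,d,0,r]) (x : ℍ[K,d,0,r]), x ∈ I → x.re ≠ 0 → I = ⊤ := by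
    intro I x hx h0
    let i : ℍ[K,d,0,r] := ⟨0, 1, 0, 0⟩
    let j : ℍ[K,d,0,r] := ⟨0, 0, 1, 0⟩
    let a : ℍ[K,d,0,r] := algebraMap K _ d⁻¹
    let b : ℍ[K,d,0,r] := algebraMap K _ r⁻¹
    let c : ℍ[K,d,0,r] := algebraMap K _ (4 * x.re)⁻¹
    have hy : x + a * (i * x * i) ∈ I :=
      I.add_mem hx (I.mul_mem_left _ _ (I.mul_mem_right _ _ (I.mul_mem_left _ _ hx)))
    have hz : c * ((x + a * (i * x * i)) + b * (j * (x + a * (i * x * i)) * j)) ∈ I :=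
      I.mul_mem_left _ _ (I.add_mem hy
        (I.mul_mem_left _ _ (I.mul_mem_right _ _ (I.mul_mem_left _ _ hy))))
    rw [← TwoSidedIdeal.one_mem_iff]
    convert hz using 1
    have h5 : d * d⁻¹ = 1 := mul_inv_cancel₀ hd
    have h6 : r * r⁻¹ = 1 := mul_inv_cancel₀ hr
    ext
    · simp [a, b, c, i, j]
      field_simp
      norm_num
    · simp [a, b, c, i, j]
      field_simp
      norm_num
    · simp [a, b, c, i, j]
      field_simp
      norm_num
    · simp [a, b, c, i, j]
      field_simp
      norm_num
  refine ⟨{ eq_bot_or_eq_top := fun I => ?_ }⟩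
  by_cases hI : I = ⊤
  · exact .inr hI
  left
  refine TwoSidedIdeal.ext fun x => ?_
  rw [TwoSidedIdeal.mem_bot]
  refine ⟨fun hx => ?_, fun hx => hx ▸ I.zero_mem⟩
  have h0 : ∀ y, (x * y).re = 0 := fun y => by
    by_contra h
    exact hI (key I _ (I.mul_mem_right _ _ hx) h)
  ext
  · simpa using h0 1
  · simpa [hd] using h0 ⟨0, 1, 0, 0⟩
  · simpa [hr] using h0 ⟨0, 0, 1, 0⟩
  · simpa [hd, hr] using h0 ⟨0, 0, 0, 1⟩

theorem isCentral_quaternionAlgebra (h2 : (2 : K) ≠ 0) {d : K} (hd : d ≠ 0) (r : K) :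
    Algebra.IsCentral K ℍ[K,d,0,r] where
  out x hx := by
    rw [Subalgebra.mem_center_iff] at hx
    have hi := hx ⟨0, 1, 0, 0⟩
    have hj := hx ⟨0, 0, 1, 0⟩
    have e : ∀ y : K, y = -y → y = 0 := fun y hy => by
      have : 2 * y = 0 := by linear_combination hy
      simpa [h2] using this
    have h3 : x.imK = 0 := by
      have := congr_arg QuaternionAlgebra.imJ hi
      simp at this
      have := e (d * x.imK) (by linear_combination this)
      simpa [hd] using this
    have h4 : x.imJ = 0 := by
      have := congr_arg QuaternionAlgebra.imK hi
      simp at this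
      exact e _ (by linear_combination this)
    have h5 : x.imI = 0 := by
      have := congr_arg QuaternionAlgebra.imK hj
      simp at this
      exact e _ (by linear_combination -this)
    exact ⟨x.re, by ext <;> simp [h3, h4, h5]⟩

/-- The quaternion algebra `(d, r)` as a central simple algebra. -/
noncomputable def quaternionCSA (h2 : (2 : K) ≠ 0) {d r : K} (hd : d ≠ 0) (hr : r ≠ 0) :
    CSA.{u, u} K :=
  haveI := isSimpleRing_quaternionAlgebra h2 hd hr
  haveI := isCentral_quaternionAlgebra h2 hd r
  haveI : FiniteDimensional K ℍ[K,d,0,r] := .of_basis (QuaternionAlgebra.basisOneIJK d 0 r)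
  csaOf K ℍ[K,d,0,r]

/-- The Brauer class of the quaternion algebra `(d, r)`. -/
noncomputable def quat (h2 : (2 : K) ≠ 0) {d r : K} (hd : d ≠ 0) (hr : r ≠ 0) :
    BrauerGroup.{u, u} K :=
  cls (quaternionCSA h2 hd hr)

theorem finrank_quaternionCSA (h2 : (2 : K) ≠ 0) {d r : K} (hd : d ≠ 0) (hr : r ≠ 0) :
    Module.finrank K (quaternionCSA h2 hd hr) = 4 :=
  QuaternionAlgebra.finrank_eq_four d 0 r

theorem exists_quaternionCSA_basis (h2 : (2 : K) ≠ 0) {d r : K} (hd : d ≠ 0) (hr : r ≠ 0) :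
    ∃ i j : quaternionCSA h2 hd hr, i * i = algebraMap K _ d ∧ j * j = algebraMap K _ r ∧
      j * i = -(i * j) := by
  refine ⟨(⟨0, 1, 0, 0⟩ : ℍ[K,d,0,r]), (⟨0, 0, 1, 0⟩ : ℍ[K,d,0,r]), ?_, ?_, ?_⟩
  · change (⟨0, 1, 0, 0⟩ : ℍ[K,d,0,r]) * ⟨0, 1, 0, 0⟩ = algebraMap K ℍ[K,d,0,r] d
    ext <;> simp
  · change (⟨0, 0, 1, 0⟩ : ℍ[K,d,0,r]) * ⟨0, 0, 1, 0⟩ = algebraMap K ℍ[K,d,0,r] r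
    ext <;> simp
  · change (⟨0, 0, 1, 0⟩ : ℍ[K,d,0,r]) * ⟨0, 1, 0, 0⟩ =
      -((⟨0, 1, 0, 0⟩ : ℍ[K,d,0,r]) * ⟨0, 0, 1, 0⟩)
    ext <;> simp

/-- The image is spanned by `1, i, j, ij`, so commuting with `i` and `j` suffices to centralize it;
the last clause serves to place elements in that centralizer. -/
theorem exists_quaternionCSA_algHom (h2 : (2 : K) ≠ 0) {d r : K} (hd : d ≠ 0) (hr : r ≠ 0)
    {A : Type*} [Ring A] [Algebra K A] {i j : A}
    (hi : i * i = algebraMap K A d) (hj : j * j = algebraMap K A r) (hij : j * i = -(i * j)) :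
    ∃ f : quaternionCSA h2 hd hr →ₐ[K] A, i ∈ f.range ∧ j ∈ f.range ∧
      ∀ a : A, a * i = i * a → a * j = j * a → ∀ x, a * f x = f x * a := by
  let q : QuaternionAlgebra.Basis A d 0 r :=
    { i := i
      j := j
      k := i * j
      i_mul_i := by rw [hi, Algebra.algebraMap_eq_smul_one, zero_smul, add_zero]
      j_mul_j := by rw [hj, Algebra.algebraMap_eq_smul_one]
      i_mul_j := rfl
      j_mul_i := by rw [hij, zero_smul, zero_sub] }
  let f : ℍ[K,d,0,r] →ₐ[K] A := q.liftHom
  refine ⟨f, ⟨(⟨0, 1, 0, 0⟩ : ℍ[K,d,0,r]), ?_⟩, ⟨(⟨0, 0, 1, 0⟩ : ℍ[K,d,0,r]), ?_⟩, ?_⟩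
  · change q.lift _ = i
    simp [QuaternionAlgebra.Basis.lift, q]
  · change q.lift _ = j
    simp [QuaternionAlgebra.Basis.lift, q]
  · intro a hai haj x
    change ℍ[K,d,0,r] at x
    change a * q.lift x = q.lift x * a
    have h : a * (i * j) = i * j * a := by rw [← mul_assoc, hai, mul_assoc, haj, mul_assoc]
    simp only [QuaternionAlgebra.Basis.lift, mul_add, add_mul, mul_smul_comm, smul_mul_assoc, q,
      hai, haj, h, Algebra.commutes]

theorem cls_eq_quat (h2 : (2 : K) ≠ 0) {d r : K} (hd : d ≠ 0) (hr : r ≠ 0) {A : CSA.{u, u} K}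
    (hA : Module.finrank K A = 4) {i j : A} (hi : i * i = algebraMap K A d)
    (hj : j * j = algebraMap K A r) (hij : j * i = -(i * j)) : cls A = quat h2 hd hr := by
  obtain ⟨f, -, -, -⟩ := exists_quaternionCSA_algHom h2 hd hr hi hj hij
  have h1 : Function.Injective f := f.toRingHom.injective
  have h3 : Function.Surjective f :=
    (LinearMap.injective_iff_surjective_of_finrank_eq_finrank (f := f.toLinearMap)
      (by rw [finrank_quaternionCSA, hA])).1 h1
  exact (cls_eq_of_algEquiv (AlgEquiv.ofBijective f ⟨h1, h3⟩)).symm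

theorem quat_congr (h2 : (2 : K) ≠ 0) {d r d' r' : K} (hd : d ≠ 0) (hr : r ≠ 0)
    (e : d = d') (e' : r = r') :
    quat h2 hd hr = quat h2 (e ▸ hd : d' ≠ 0) (e' ▸ hr : r' ≠ 0) := by
  subst e e'
  rfl

theorem res_quat {L : Type u} [Field L] [Algebra K L] (h2 : (2 : K) ≠ 0) (h2' : (2 : L) ≠ 0)
    {d r : K} (hd : d ≠ 0) (hr : r ≠ 0) :
    res K L (quat h2 hd hr) =
      quat h2' ((map_ne_zero (algebraMap K L)).2 hd) ((map_ne_zero (algebraMap K L)).2 hr) := by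
  let H := quaternionCSA h2 hd hr
  obtain ⟨i, j, hi, hj, hij⟩ : ∃ i j : H, i * i = algebraMap K _ d ∧ j * j = algebraMap K _ r ∧
    j * i = -(i * j) := exists_quaternionCSA_basis h2 hd hr
  rw [quat, res_cls]
  have hmap : ∀ k : K, (1 : L) ⊗ₜ[K] (algebraMap K H k) = algebraMap L (L ⊗[K] H)
      (algebraMap K L k) := fun k => by
    rw [← Algebra.TensorProduct.algebraMap_apply', ← IsScalarTower.algebraMap_apply]
  have hmul : ∀ x y : H, (1 ⊗ₜ x : L ⊗[K] H) * (1 ⊗ₜ y) = 1 ⊗ₜ (x * y) := fun x y => by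
    rw [Algebra.TensorProduct.tmul_mul_tmul, one_mul]
  refine cls_eq_quat h2' _ _ (A := baseChange K L (quaternionCSA h2 hd hr))
    (i := (1 ⊗ₜ i : L ⊗[K] H)) (j := (1 ⊗ₜ j : L ⊗[K] H)) ?_ ?_ ?_ ?_
  · exact (Module.finrank_baseChange ..).trans (finrank_quaternionCSA h2 hd hr)
  · exact (hmul i i).trans (by rw [hi, hmap]; rfl)
  · exact (hmul j j).trans (by rw [hj, hmap]; rfl)
  · exact (hmul j i).trans (by rw [hij, TensorProduct.tmul_neg, ← hmul]; rfl)

theorem quat_eq_one (h2 : (2 : K) ≠ 0) {d r : K} (hd : d ≠ 0) (hr : r ≠ 0) {δ : K}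
    (h : δ ^ 2 = d) : quat h2 hd hr = 1 := by
  rw [← cls_self, ← cls_matrix (csaOf K K) 2]
  -- When `d = δ²`, a diagonal matrix with entries `±δ` and a twisted permutation matrix satisfy the
  -- quaternion relations.
  refine (cls_eq_quat h2 hd hr (A := csaOf K (Matrix (Fin 2) (Fin 2) (csaOf K K)))
    (i := (!![δ, 0; 0, -δ] : Matrix (Fin 2) (Fin 2) K))
    (j := (!![0, r; 1, 0] : Matrix (Fin 2) (Fin 2) K)) ?_ ?_ ?_ ?_).symm
  · change Module.finrank K (Matrix (Fin 2) (Fin 2) K) = 4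
    simp [Module.finrank_matrix]
  · change (!![δ, 0; 0, -δ] : Matrix (Fin 2) (Fin 2) K) * !![δ, 0; 0, -δ] =
      algebraMap K (Matrix (Fin 2) (Fin 2) K) d
    rw [← h]
    ext i j
    fin_cases i <;> fin_cases j <;> simp [Matrix.algebraMap_matrix_apply, sq]
  · change (!![0, r; 1, 0] : Matrix (Fin 2) (Fin 2) K) * !![0, r; 1, 0] =
      algebraMap K (Matrix (Fin 2) (Fin 2) K) r
    ext i j
    fin_cases i <;> fin_cases j <;> simp [Matrix.algebraMap_matrix_apply]
  · change (!![0, r; 1, 0] : Matrix (Fin 2) (Fin 2) K) * !![δ, 0; 0, -δ] =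
      -((!![δ, 0; 0, -δ] : Matrix (Fin 2) (Fin 2) K) * !![0, r; 1, 0])
    ext i j
    fin_cases i <;> fin_cases j <;> simp [mul_comm]

/-- Quaternion conjugation identifies the algebra with its opposite. -/
theorem quat_sq (h2 : (2 : K) ≠ 0) {d r : K} (hd : d ≠ 0) (hr : r ≠ 0) :
    quat h2 hd hr ^ 2 = 1 := by
  have : quat h2 hd hr = (quat h2 hd hr)⁻¹ := by
    conv_rhs => rw [quat, ← cls_opp]
    exact cls_eq_of_algEquiv (A := quaternionCSA h2 hd hr) (B := opp (quaternionCSA h2 hd hr))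
      (QuaternionAlgebra.starAe (R := K) (c₁ := d) (c₂ := 0) (c₃ := r))
  rw [sq]
  conv_lhs => rw [this]; arg 2; rw [← this]
  simp

theorem cls_eq_one_of_finrank {A : CSA.{u, u} K} (h : Module.finrank K A = 1) : cls A = 1 := by
  have hb : Function.Bijective (Algebra.ofId K A) :=
    ⟨(algebraMap K A).injective, Algebra.surjective_algebraMap_iff.2
      (Subalgebra.bot_eq_top_iff_finrank_eq_one.2 h).symm⟩
  exact (cls_eq_of_algEquiv (A := csaOf K K) (B := A) (AlgEquiv.ofBijective _ hb)).symm

end Quaternion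

end BrauerGroup

/-! ### Involutions of the first kind fixing a self-centralizing subfield. -/

section SelfCentralizing

variable {F M B : Type*} [Field F] [Field M] [Algebra F M] [FiniteDimensional F M] [Ring B]
  [Algebra F B] [Algebra.IsCentral F B] [IsSimpleRing B] [FiniteDimensional F B]

theorem exists_unit_mul_eq (ι ι' : M →ₐ[F] B) :
    ∃ w : Bˣ, ∀ m, w * ι m = ι' m * w := by
  obtain ⟨w, hw⟩ := skolem_noether ι ι'
  exact ⟨w, fun m => by rw [hw, mul_assoc, Units.inv_mul, mul_one]⟩

theorem exists_unit_mul_eq_gal (ι : M →ₐ[F] B) (g : Gal(M/F)) :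
    ∃ w : Bˣ, ∀ m, w * ι m = ι (g m) * w :=
  exists_unit_mul_eq ι (ι.comp (g : M →ₐ[F] M))

/-- A linear antiautomorphism that is the identity on a self-centralizing multiquadratic Galois
extension is an involution. -/
theorem involutive_of_fixes_selfCentralizing [IsGalois F M]
    (hgal : ∀ g : Gal(M/F), ∀ m, g (g m) = m)
    (ι : M →ₐ[F] B) (hι : ∀ b, (∀ m, b * ι m = ι m * b) → ∃ m, b = ι m)
    (σ : B →ₗ[F] B) (h1 : σ 1 = 1) (hmul : ∀ x y, σ (x * y) = σ y * σ x)
    (hσ : ∀ m, σ (ι m) = ι m) (x : B) : σ (σ x) = x := by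
  -- Since `g² = 1`, the element `σ u` also induces `g`, so `σ u = p u` with `p` in `M`. As `u²`
  -- lies in `M` it is fixed by `σ`, which forces `p · g p = 1`; this is what `σ (σ u) = u` needs.
  have hunit : ∀ (g : Gal(M/F)) (u : Bˣ), (∀ m, u * ι m = ι (g m) * u) → σ (σ u) = u := by
    intro g u hu
    have hv : ∀ m, ι m * σ u = σ u * ι (g m) := fun m => by
      have := congr_arg σ (hu m)
      rwa [hmul, hmul, hσ, hσ] at this
    have hu' : ∀ m, ↑u⁻¹ * ι (g m) = ι m * ↑u⁻¹ := fun m => by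
      rw [Units.inv_mul_eq_iff_eq_mul, ← mul_assoc, hu, mul_assoc, Units.mul_inv, mul_one]
    obtain ⟨p, hp⟩ := hι (σ u * ↑u⁻¹) fun m => by
      obtain ⟨m, rfl⟩ := g.surjective m
      have := hv (g m)
      rw [hgal] at this
      rw [mul_assoc, hu', ← mul_assoc, ← mul_assoc, this]
    have hp' : σ u = ι p * u := by rw [← hp, mul_assoc, Units.inv_mul, mul_one]
    obtain ⟨q, hq⟩ := hι (u * u) fun m => by
      rw [mul_assoc, hu, ← mul_assoc, hu, hgal, mul_assoc]
    have h2 : ι p * ι (g p) * (u * u) = u * u := by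
      have h3 := congr_arg σ hq
      rw [hσ, ← hq, hmul, hp'] at h3
      rw [mul_assoc, ← mul_assoc (u : B), hu] at h3
      simpa only [mul_assoc] using h3
    have h3 : ι p * ι (g p) = 1 := by
      have := congr($h2 * (↑u⁻¹ * ↑u⁻¹))
      simpa [mul_assoc] using this
    rw [hp', hmul, hσ, hp', mul_assoc, hu, ← mul_assoc, h3, one_mul]
  -- `σ²` is an inner automorphism. Being trivial on `M`, it is induced by some `p` in `M`; being
  -- trivial on units inducing each `g`, it forces `p` to be Galois invariant, hence central.
  let s : B →ₐ[F] B := AlgHom.ofLinearMap (σ ∘ₗ σ) (by simp [h1]) fun x y => by simp [hmul]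
  obtain ⟨w, hw⟩ := skolem_noether s (AlgHom.id F B)
  have hw' : ∀ x, x * w = w * σ (σ x) := fun x => by
    have : x = w * σ (σ x) * ↑w⁻¹ := hw x
    conv_lhs => rw [this]
    rw [mul_assoc, Units.inv_mul, mul_one]
  obtain ⟨p, hp⟩ := hι w fun m => by rw [hw', hσ, hσ]
  have hfix : ∀ g : Gal(M/F), g p = p := by
    intro g
    obtain ⟨u, hu⟩ := exists_unit_mul_eq_gal ι g
    have h3 := hw' u
    rw [hunit g u hu, hp, hu] at h3
    exact ι.toRingHom.injective (u.isUnit.mul_left_inj.1 h3)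
  obtain ⟨k, rfl⟩ := IsGalois.mem_range_algebraMap_iff_fixed p |>.2 hfix
  rw [AlgHom.commutes] at hp
  have h3 := hw' x
  rw [hp, ← Algebra.commutes, ← hp] at h3
  exact (w.isUnit.mul_right_inj.1 h3).symm

/-- Albert's theorem for algebras containing a self-centralizing multiquadratic extension. -/
theorem exists_involution_of_algEquiv_op [IsGalois F M]
    (hgal : ∀ g : Gal(M/F), ∀ m, g (g m) = m)
    (ι : M →ₐ[F] B) (hι : ∀ b, (∀ m, b * ι m = ι m * b) → ∃ m, b = ι m)
    (e : B ≃ₐ[F] Bᵐᵒᵖ) :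
    ∃ σ : B →ₗ[F] B, σ 1 = 1 ∧ (∀ x y, σ (x * y) = σ y * σ x) ∧ (∀ m, σ (ι m) = ι m) ∧
      ∀ x, σ (σ x) = x := by
  have : Algebra.IsCentral F Bᵐᵒᵖ := inferInstance
  -- Correcting `e` by an inner automorphism makes the resulting antiautomorphism the identity on
  -- `M`.
  obtain ⟨w, hw⟩ := skolem_noether (e.toAlgHom.comp ι)
    (ι.toOpposite fun x y => by rw [Commute, SemiconjBy, ← map_mul, ← map_mul, mul_comm])
  let θ : B →ₗ[F] Bᵐᵒᵖ :=
    { toFun := fun x => innerAut w (e x)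
      map_add' := fun x y => by simp
      map_smul' := fun k x => by simp [innerAut_apply] }
  let σ : B →ₗ[F] B := (MulOpposite.opLinearEquiv F (M := B)).symm.toLinearMap ∘ₗ θ
  have hσ : ∀ x, σ x = (innerAut w (e x)).unop := fun x => rfl
  have h1 : σ 1 = 1 := by rw [hσ, map_one, map_one, MulOpposite.unop_one]
  have hmul : ∀ x y, σ (x * y) = σ y * σ x := fun x y => by
    rw [hσ, map_mul, map_mul, MulOpposite.unop_mul, hσ, hσ]
  have hfix : ∀ m, σ (ι m) = ι m := fun m => (congr_arg MulOpposite.unop (hw m)).symm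
  exact ⟨σ, h1, hmul, hfix,
    involutive_of_fixes_selfCentralizing hgal ι hι σ h1 hmul hfix⟩

end SelfCentralizing

/-! ### Classes split by a quadratic extension. -/

namespace BrauerGroup

/-- A unit `u` inducing `g` has `u²` in `L`. Since `u` commutes with `u²`, this square is fixed by
`g` and lies in `K`, so `δ` and `u` are quaternion generators. -/
theorem exists_eq_quat {K L : Type u} [Field K] [Field L] [Algebra K L] [FiniteDimensional K L]
    (h2 : (2 : K) ≠ 0)
    {d : K} (hd : d ≠ 0) {δ : L} (hδ : δ ^ 2 = algebraMap K L d) (g : Gal(L/K)) (hg : g δ = -δ)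
    (hgg : ∀ x, g (g x) = x) (hfix : ∀ x, g x = x → x ∈ Set.range (algebraMap K L))
    {B : CSA.{u, u} K} (hB : Module.finrank K B = 4) (ι : L →ₐ[K] B)
    (hι : ∀ b, (∀ m, b * ι m = ι m * b) → ∃ m, b = ι m) :
    ∃ (t : K) (ht : t ≠ 0), cls B = quat h2 hd ht := by
  obtain ⟨u, hu⟩ := exists_unit_mul_eq_gal ι g
  obtain ⟨q, hq⟩ := hι (u * u) fun m => by
    rw [mul_assoc, hu, ← mul_assoc, hu, hgg, mul_assoc]
  obtain ⟨t, rfl⟩ := hfix q (by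
    have h1 : u * (u * u : B) = (u * u) * u := (mul_assoc ..).symm
    rw [hq, hu] at h1
    exact ι.toRingHom.injective (u.isUnit.mul_left_inj.1 h1))
  rw [AlgHom.commutes] at hq
  have ht : t ≠ 0 := by
    rintro rfl
    rw [map_zero] at hq
    exact (u * u).ne_zero (by rw [Units.val_mul, hq])
  refine ⟨t, ht, cls_eq_quat h2 hd ht hB (i := ι δ) (j := u) ?_ hq ?_⟩
  · rw [← map_mul, ← sq, hδ, AlgHom.commutes]
  · rw [hu, hg, map_neg, neg_mul]

theorem exists_eq_quat_of_mem_relBr {K L : Type u} [Field K] [Field L] [Algebra K L]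
    (hdeg : Module.finrank K L = 2) (h2 : (2 : K) ≠ 0)
    {d : K} (hd : d ≠ 0) {δ : L} (hδ : δ ^ 2 = algebraMap K L d) (g : Gal(L/K)) (hg : g δ = -δ)
    (hgg : ∀ x, g (g x) = x) (hfix : ∀ x, g x = x → x ∈ Set.range (algebraMap K L))
    {x : BrauerGroup.{u, u} K} (hx : x ∈ relBr K L) :
    ∃ (t : K) (ht : t ≠ 0), x = quat h2 hd ht := by
  have : FiniteDimensional K L := .of_finrank_pos (by omega)
  obtain ⟨B, ι, rfl, hB, hι⟩ := exists_selfCentralizing hx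
  exact exists_eq_quat h2 hd hδ g hg hgg hfix (by rw [hB, hdeg]; norm_num) ι hι

end BrauerGroup

/-! ### Galois theory of multiquadratic extensions. -/

section Multiquadratic

variable {F M : Type*} [Field F] [Field M] [Algebra F M]

theorem two_ne_zero_of_algebra (h2 : (2 : F) ≠ 0) : (2 : M) ≠ 0 := by
  have := (map_ne_zero (algebraMap F M)).2 h2
  rwa [map_ofNat] at this

theorem gal_apply_eq_or_eq_neg (g : Gal(M/F)) {x : M} {d : F} (hx : x ^ 2 = algebraMap F M d) :
    g x = x ∨ g x = -x := by
  rw [← sq_eq_sq_iff_eq_or_eq_neg, ← map_pow, hx, AlgEquiv.commutes]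

variable {n : ℕ} {s : Fin n → M} {d : Fin n → F}

open Polynomial in
-- Each generator is a root of `X² - dᵢ`, which is separable away from characteristic two and splits
-- in `M` as `(X - sᵢ)(X + sᵢ)`.
theorem isGalois_of_adjoin_sqrt (h2 : (2 : F) ≠ 0) (hd : ∀ i, d i ≠ 0)
    (hs : ∀ i, s i ^ 2 = algebraMap F M (d i))
    (htop : IntermediateField.adjoin F (Set.range s) = ⊤) : IsGalois F M := by
  have hroot : ∀ i, aeval (s i) (X ^ 2 - C (d i)) = 0 := fun i => by simp [hs]
  have hmonic : ∀ i, (X ^ 2 - C (d i)).Monic := fun i => monic_X_pow_sub_C _ two_ne_zero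
  have hint : ∀ i, IsIntegral F (s i) := fun i => ⟨_, hmonic i, hroot i⟩
  have hsep : Algebra.IsSeparable F M := by
    have : Algebra.IsSeparable F (IntermediateField.adjoin F (Set.range s)) := by
      rw [IntermediateField.isSeparable_adjoin_iff_isSeparable]
      rintro _ ⟨i, rfl⟩
      exact (separable_X_pow_sub_C (d i) (by simpa using h2) (hd i)).of_dvd
        (minpoly.dvd F _ (hroot i))
    rw [htop] at this
    exact Algebra.IsSeparable.of_algHom F _
      (IntermediateField.topEquiv (F := F) (E := M)).symm.toAlgHom
  have hnormal : Normal F M := by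
    have hint' : Algebra.IsAlgebraic F M := inferInstance
    refine ⟨fun x => ?_⟩
    have hx : x ∈ IntermediateField.adjoin F (Set.range s) := by rw [htop]; trivial
    refine IntermediateField.splits_of_mem_adjoin F M ?_ hx
    rintro _ ⟨i, rfl⟩
    refine ⟨hint i, ?_⟩
    have h1 : ((X ^ 2 - C (d i)).map (algebraMap F M)).Splits := by
      have : (X ^ 2 - C (d i)).map (algebraMap F M) = (X - C (s i)) * (X - C (-s i)) := by
        simp only [Polynomial.map_sub, Polynomial.map_pow, map_X, map_C, ← hs, map_neg, map_pow]
        ring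
      rw [this]
      exact (Splits.X_sub_C _).mul (Splits.X_sub_C _)
    exact h1.of_dvd (by simpa using (hmonic i).map (algebraMap F M) |>.ne_zero)
      (Polynomial.map_dvd _ (minpoly.dvd F _ (hroot i)))
  exact ⟨⟩

theorem gal_ext_of_adjoin (htop : IntermediateField.adjoin F (Set.range s) = ⊤)
    {g h : Gal(M/F)} (hgh : ∀ i, g (s i) = h (s i)) : g = h := by
  have : (g : M →ₐ[F] M) = h := by
    have h1 : ∀ x ∈ IntermediateField.adjoin F (Set.range s), g x = h x := by
      intro x hx
      induction hx using IntermediateField.adjoin_induction with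
      | mem x hx => obtain ⟨i, rfl⟩ := hx; exact hgh i
      | algebraMap x => simp
      | add x y _ _ hx hy => rw [map_add, map_add, hx, hy]
      | inv x _ hx => rw [map_inv₀, map_inv₀, hx]
      | mul x y _ _ hx hy => rw [map_mul, map_mul, hx, hy]
    ext x
    exact h1 x (by rw [htop]; trivial)
  ext x
  exact congr($this x)

theorem gal_gal_apply (hs : ∀ i, s i ^ 2 = algebraMap F M (d i))
    (htop : IntermediateField.adjoin F (Set.range s) = ⊤) (g : Gal(M/F)) (x : M) :
    g (g x) = x := by
  have : g * g = 1 := gal_ext_of_adjoin htop fun i => by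
    rcases gal_apply_eq_or_eq_neg g (hs i) with h | h <;> simp [h]
  exact congr($this x)

/-- All combinations of sign changes of the square roots are realized by automorphisms. -/
theorem exists_gal_of_signs (h2 : (2 : F) ≠ 0) (hd : ∀ i, d i ≠ 0)
    (hs : ∀ i, s i ^ 2 = algebraMap F M (d i))
    (htop : IntermediateField.adjoin F (Set.range s) = ⊤)
    (hdeg : Module.finrank F M = 2 ^ n) (ε : Fin n → Bool) :
    ∃ g : Gal(M/F), ∀ i, g (s i) = if ε i then -s i else s i := by
  classical
  have := isGalois_of_adjoin_sqrt h2 hd hs htop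
  have : FiniteDimensional F M := .of_finrank_pos (by rw [hdeg]; positivity)
  have h2' : (2 : M) ≠ 0 := two_ne_zero_of_algebra h2
  have hs0 : ∀ i, s i ≠ 0 := fun i h => hd i (by
    have := hs i
    rwa [h, zero_pow two_ne_zero, eq_comm, map_eq_zero] at this)
  have hsn : ∀ i, -s i ≠ s i := fun i h => by
    have : 2 * s i = 0 := by linear_combination -h
    exact (mul_ne_zero h2' (hs0 i)) this
  -- An automorphism is determined by its signs, and there are `2 ^ n` automorphisms and `2 ^ n`
  -- sign patterns, so every pattern occurs.
  let f : Gal(M/F) → (Fin n → Bool) := fun g i => decide (g (s i) = -s i)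
  have hinj : Function.Injective f := by
    intro g h hgh
    refine gal_ext_of_adjoin htop fun i => ?_
    have h1 : g (s i) = -s i ↔ h (s i) = -s i := by simpa [f] using congr_fun hgh i
    rcases gal_apply_eq_or_eq_neg g (hs i) with hg | hg <;>
      rcases gal_apply_eq_or_eq_neg h (hs i) with hh | hh
    · rw [hg, hh]
    · rw [h1.2 hh, hh]
    · rw [hg, h1.1 hg]
    · rw [hg, hh]
  have hsurj : Function.Surjective f := by
    refine (Fintype.bijective_iff_injective_and_card f).2 ⟨hinj, ?_⟩ |>.2
    rw [← Nat.card_eq_fintype_card, IsGalois.card_aut_eq_finrank, hdeg]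
    simp
  obtain ⟨g, hg⟩ := hsurj ε
  refine ⟨g, fun i => ?_⟩
  have h1 := congr_fun hg i
  by_cases hε : ε i
  · rw [if_pos hε]
    rw [hε] at h1
    simpa [f] using h1
  · rw [if_neg hε]
    rcases gal_apply_eq_or_eq_neg g (hs i) with h | h
    · exact h
    · rw [← h1] at hε
      simp [f, h] at hε

end Multiquadratic

/-! ### Quadratic extensions. -/

section Quadratic

variable {K L : Type*} [Field K] [Field L] [Algebra K L] {β : L} {b : K}

theorem adjoin_eq_top_of_finrank_two (hdeg : Module.finrank K L = 2)
    (hβ : β ∉ Set.range (algebraMap K L)) : IntermediateField.adjoin K {β} = ⊤ := by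
  have := IntermediateField.isSimpleOrder_of_finrank_prime K L (by rw [hdeg]; exact Nat.prime_two)
  rcases eq_bot_or_eq_top (IntermediateField.adjoin K {β}) with h | h
  · rw [IntermediateField.adjoin_simple_eq_bot_iff, IntermediateField.mem_bot] at h
    exact absurd h hβ
  · exact h

theorem exists_gal_neg (h2 : (2 : K) ≠ 0) (hdeg : Module.finrank K L = 2) (hb : b ≠ 0)
    (hβ2 : β ^ 2 = algebraMap K L b) (hβ : IntermediateField.adjoin K {β} = ⊤) :
    ∃ g : Gal(L/K), g β = -β ∧ (∀ x, g (g x) = x) ∧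
      ∀ x, g x = x → x ∈ Set.range (algebraMap K L) := by
  have hr : Set.range (fun _ : Fin 1 => β) = {β} := Set.range_const
  have htop : IntermediateField.adjoin K (Set.range (fun _ : Fin 1 => β)) = ⊤ := by rw [hr, hβ]
  have hs : ∀ i : Fin 1, (fun _ => β) i ^ 2 = algebraMap K L ((fun _ => b) i) := fun _ => hβ2
  have hG := isGalois_of_adjoin_sqrt h2 (fun _ => hb) hs htop
  have hF : FiniteDimensional K L := .of_finrank_pos (by rw [hdeg]; norm_num)
  obtain ⟨g, hg⟩ := exists_gal_of_signs h2 (fun _ => hb) hs htop hdeg fun _ => true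
  refine ⟨g, by simpa using hg 0, gal_gal_apply hs htop g, fun x hx => ?_⟩
  rw [IsGalois.mem_range_algebraMap_iff_fixed]
  intro h
  rcases gal_apply_eq_or_eq_neg h hβ2 with hh | hh
  · have : h = 1 := gal_ext_of_adjoin htop fun i => by simpa using hh
    rw [this]; rfl
  · have : h = g := gal_ext_of_adjoin htop fun i => by simpa [hh] using (hg 0).symm
    rw [this, hx]

/-- The even and odd parts of `x` under `g` give the two coordinates. -/
theorem exists_eq_add_mul_sqrt (h2 : (2 : K) ≠ 0) (hβ0 : β ≠ 0) {g : Gal(L/K)} (hg : g β = -β)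
    (hgg : ∀ x, g (g x) = x) (hfix : ∀ x, g x = x → x ∈ Set.range (algebraMap K L)) (x : L) :
    ∃ p q : K, x = algebraMap K L p + algebraMap K L q * β := by
  have h2' : (2 : L) ≠ 0 := two_ne_zero_of_algebra h2
  obtain ⟨p, hp⟩ := hfix ((x + g x) / 2) (by rw [map_div₀, map_add, hgg, map_ofNat, add_comm])
  obtain ⟨q, hq⟩ := hfix ((x - g x) / (2 * β)) (by
    rw [map_div₀, map_sub, hgg, map_mul, map_ofNat, hg]
    field_simp
    ring)
  refine ⟨p, q, ?_⟩
  rw [hp, hq]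
  field_simp
  ring

end Quadratic

/-! ### Cyclic algebras inside multiquadratic extensions are quaternion algebras. -/

namespace BrauerGroup

section Dec

/-- Scalar extension in a tower, for a possibly noncommutative algebra. -/
noncomputable def baseChangeTower (F K M A : Type*) [Field F] [Field K] [Field M] [Algebra F K]
    [Algebra K M] [Algebra F M] [IsScalarTower F K M] [Ring A] [Algebra F A] :
    M ⊗[K] (K ⊗[F] A) ≃ₐ[M] M ⊗[F] A :=
  AlgEquiv.symm <| AlgEquiv.ofLinearEquiv
    (TensorProduct.AlgebraTensorModule.cancelBaseChange F K M M A).symm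
    (by simp [Algebra.TensorProduct.one_def]) <|
      LinearMap.map_mul_of_map_mul_tmul (fun _ _ _ _ ↦ by simp)

theorem res_res {F K M : Type u} [Field F] [Field K] [Field M] [Algebra F K] [Algebra K M]
    [Algebra F M] [IsScalarTower F K M] (x : BrauerGroup.{u, u} F) :
    res K M (res F K x) = res F M x := by
  obtain ⟨A, rfl⟩ := Quotient.exists_rep x
  exact cls_eq_of_algEquiv (A := baseChange K M (baseChange F K A)) (B := baseChange F M A)
    (baseChangeTower F K M A)

variable {K M : Type u} [Field K] [Field M] [Algebra K M]

theorem mem_relBr_iff {x : BrauerGroup.{u, u} K} : x ∈ relBr K M ↔ res K M x = 1 := Iff.rfl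

theorem quat_mem_relBr (h2 : (2 : K) ≠ 0) {d r : K} (hd : d ≠ 0) (hr : r ≠ 0) {δ : M}
    (hδ : δ ^ 2 = algebraMap K M d) : quat h2 hd hr ∈ relBr K M := by
  rw [mem_relBr_iff, res_quat h2 (two_ne_zero_of_algebra h2)]
  exact quat_eq_one _ _ _ hδ

/-- Rescaling the generator `i` by `k` multiplies its square by `k²`. -/
theorem quat_mul_sq (h2 : (2 : K) ≠ 0) {d r k : K} (hd : d ≠ 0) (hr : r ≠ 0) (hk : k ≠ 0) :
    quat h2 (mul_ne_zero (pow_ne_zero 2 hk) hd) hr = quat h2 hd hr := by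
  obtain ⟨i, j, hi, hj, hij⟩ := exists_quaternionCSA_basis h2 hd hr
  refine (cls_eq_quat h2 _ hr (finrank_quaternionCSA h2 hd hr) (i := k • i) (j := j) ?_ hj ?_).symm
  · rw [smul_mul_smul_comm, hi, Algebra.smul_def, ← map_mul, sq]
  · rw [mul_smul_comm, hij, smul_mul_assoc, smul_neg]

/-- A cyclic algebra inside a Galois extension with Galois group of exponent two is split or a
quaternion algebra. -/
theorem eq_one_or_eq_quat_of_mem_cyclicClasses [IsGalois K M] [FiniteDimensional K M]
    (h2 : (2 : K) ≠ 0) (hgal : ∀ g : Gal(M/K), ∀ m, g (g m) = m) {S : Set K}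
    {x : BrauerGroup.{u, u} K} (hx : x ∈ cyclicClasses K M S) :
    x = 1 ∨ ∃ (d r : K) (hd : d ≠ 0) (hr : r ≠ 0) (δ : M), δ ^ 2 = algebraMap K M d ∧ r ∈ S ∧
      x = quat h2 hd hr := by
  obtain ⟨L, σ, r, A, hrS, ⟨hG, hgen, hr, hdim, ι, z, hz, hzι⟩, rfl⟩ := hx
  -- `σ` lifts to `M`, where every automorphism has order at most two; so `L` has degree one or two
  -- over `K`.
  have hσσ : ∀ x : L, σ (σ x) = x := by
    intro x
    obtain ⟨g, rfl⟩ := AlgEquiv.restrictNormalHom_surjective (F := K) (K₁ := L) M σ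
    apply (algebraMap L M).injective
    change algebraMap L M ((AlgEquiv.restrictNormal g L) ((AlgEquiv.restrictNormal g L) x)) = _
    rw [AlgEquiv.restrictNormal_commutes, AlgEquiv.restrictNormal_commutes, hgal]
  have hσ2 : σ ^ 2 = 1 := by
    ext x
    rw [sq]
    exact congr_arg (algebraMap L M) (hσσ x)
  have hcard : Module.finrank K L = orderOf σ := by
    rw [← IsGalois.card_aut_eq_finrank, ← Nat.card_zpowers]
    have : Subgroup.zpowers σ = ⊤ := by rw [eq_top_iff]; exact fun τ _ => hgen τ
    rw [this, Subgroup.card_top]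
  rcases (Nat.dvd_prime Nat.prime_two).1 (orderOf_dvd_of_pow_eq_one hσ2) with h1 | h1
  · left
    exact cls_eq_one_of_finrank (by rw [hdim, hcard, h1, one_pow])
  · right
    have hσ1 : σ ≠ 1 := by
      rintro rfl
      rw [orderOf_one] at h1
      exact absurd h1 (by norm_num)
    obtain ⟨θ, hθ⟩ : ∃ θ, σ θ ≠ θ := by
      by_contra! h
      exact hσ1 (AlgEquiv.ext h)
    -- An anti-invariant element: its square is invariant, so it generates `L` as a square root.
    let δ := θ - σ θ
    have hδ0 : δ ≠ 0 := sub_ne_zero.2 (Ne.symm hθ)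
    have hσδ : σ δ = -δ := by
      simp [δ, hσσ]
    obtain ⟨d, hd⟩ : δ ^ 2 ∈ Set.range (algebraMap K L) := by
      rw [IsGalois.mem_range_algebraMap_iff_fixed]
      intro g
      have hfix : σ (δ ^ 2) = δ ^ 2 := by rw [map_pow, hσδ, neg_sq]
      obtain ⟨k, rfl⟩ := hgen g
      have : σ ∈ MulAction.stabilizer Gal(L/K) (δ ^ 2) := hfix
      exact (Subgroup.zpow_mem _ this k)
    have hd0 : d ≠ 0 := by
      rintro rfl
      rw [map_zero] at hd
      exact pow_ne_zero 2 hδ0 hd.symm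
    refine ⟨d, r, hd0, hr, δ, ?_, hrS, ?_⟩
    · rw [IsScalarTower.algebraMap_apply K L M, hd]
      rfl
    · rw [hcard, h1] at hz hdim
      refine cls_eq_quat h2 hd0 hr (by rw [hdim]; norm_num) (i := ι δ) (j := z) ?_ ?_ ?_
      · rw [← map_mul, ← sq, ← hd, AlgHom.commutes]
      · rw [← sq, hz]
      · rw [hzι, hσδ, map_neg, neg_mul]

/-- If `δ` is in `K` the class is trivial. Otherwise `K(δ)` is quadratic and `(d, r)` is the cyclic
algebra over it, with `δ ↦ i` and `z = j`. -/
theorem quat_mem_closure_cyclicClasses (h2 : (2 : K) ≠ 0) {S : Set K} {d r : K} (hd : d ≠ 0)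
    (hr : r ≠ 0) (hrS : r ∈ S) {δ : M} (hδ : δ ^ 2 = algebraMap K M d) :
    quat h2 hd hr ∈ Subgroup.closure (cyclicClasses K M S) := by
  by_cases hδK : δ ∈ Set.range (algebraMap K M)
  · obtain ⟨k, rfl⟩ := hδK
    rw [← map_pow, (algebraMap K M).injective.eq_iff] at hδ
    rw [quat_eq_one h2 hd hr hδ]
    exact one_mem _
  · apply Subgroup.subset_closure
    have hδ0 : δ ≠ 0 := by
      rintro rfl
      exact hδK ⟨0, map_zero _⟩
    open Polynomial in
    have hroot : aeval δ (X ^ 2 - C d) = 0 := by simp [hδ]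
    open Polynomial in
    have hmonic : (X ^ 2 - C d).Monic := monic_X_pow_sub_C _ two_ne_zero
    have hint : IsIntegral K δ := ⟨_, hmonic, hroot⟩
    open Polynomial in
    -- A nonzero polynomial of degree at most one vanishing at `δ` would put `δ` in `K`.
    have hmin : X ^ 2 - C d = minpoly K δ := by
      refine minpoly.unique' K δ hmonic hroot fun q hq => ?_
      by_contra! h
      obtain ⟨h3, h4⟩ := h
      rw [degree_X_pow_sub_C (by norm_num)] at hq
      have hq1 : q.degree ≤ 1 := by
        exact Order.le_of_lt_succ hq
      rw [eq_X_add_C_of_degree_le_one hq1] at h4 h3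
      simp only [map_add, map_mul, aeval_C, aeval_X] at h4
      by_cases h5 : q.coeff 1 = 0
      · rw [h5, map_zero, zero_mul, zero_add, map_eq_zero] at h4
        rw [h5, h4] at h3
        simp at h3
      · apply hδK
        refine ⟨-q.coeff 0 / q.coeff 1, ?_⟩
        rw [map_div₀, map_neg, div_eq_iff ((_root_.map_ne_zero _).2 h5)]
        linear_combination -h4
    let L := IntermediateField.adjoin K {δ}
    let β : L := IntermediateField.AdjoinSimple.gen K δ
    have hdeg : Module.finrank K L = 2 := by
      rw [IntermediateField.adjoin.finrank hint, ← hmin, Polynomial.natDegree_X_pow_sub_C]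
    have hβ : β ^ 2 = algebraMap K L d := by
      apply (algebraMap L M).injective
      rw [map_pow, IntermediateField.AdjoinSimple.algebraMap_gen, hδ,
        IsScalarTower.algebraMap_apply K L M]
    have hβK : β ∉ Set.range (algebraMap K L) := by
      rintro ⟨k, hk⟩
      apply hδK
      refine ⟨k, ?_⟩
      rw [IsScalarTower.algebraMap_apply K L M, hk]
      exact IntermediateField.AdjoinSimple.algebraMap_gen K δ
    have hβ0 : β ≠ 0 := fun h => hβK ⟨0, by rw [h, map_zero]⟩
    have htop := adjoin_eq_top_of_finrank_two hdeg hβK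
    obtain ⟨g, hg, hgg, hfix⟩ := exists_gal_neg h2 hdeg hd hβ htop
    have hG : IsGalois K L :=
      isGalois_of_adjoin_sqrt (s := fun _ : Fin 1 => β) h2 (fun _ => hd) (fun _ => hβ)
        (by rw [Set.range_const]; exact htop)
    obtain ⟨i, j, hi, hj, hij⟩ := exists_quaternionCSA_basis h2 hd hr
    let pb := IntermediateField.adjoin.powerBasis hint
    have hgen : pb.gen = β := IntermediateField.adjoin.powerBasis_gen hint
    have hy : Polynomial.aeval i (minpoly K pb.gen) = 0 := by
      rw [hgen, IntermediateField.minpoly_gen, ← hmin]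
      simp [sq, hi]
    let ι := pb.lift i hy
    have hι : ι β = i := by
      rw [← hgen]
      exact pb.lift_gen i hy
    refine ⟨L, g, r, quaternionCSA h2 hd hr, hrS, ⟨hG, ?_, hr, ?_, ι, j, ?_, ?_⟩, rfl⟩
    · intro τ
      rcases gal_apply_eq_or_eq_neg τ hβ with h | h
      · have : τ = 1 := gal_ext_of_adjoin (s := fun _ : Fin 1 => β)
          (by rw [Set.range_const]; exact htop) fun i => h
        rw [this]
        exact one_mem _
      · have : τ = g := gal_ext_of_adjoin (s := fun _ : Fin 1 => β)
          (by rw [Set.range_const]; exact htop) fun i => h.trans hg.symm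
        rw [this]
        exact Subgroup.mem_zpowers g
    · rw [finrank_quaternionCSA, hdeg]; norm_num
    · rw [hdeg, sq, hj]
    · intro x
      obtain ⟨p, q, rfl⟩ := exists_eq_add_mul_sqrt h2 hβ0 hg hgg hfix x
      simp only [map_add, map_mul, AlgHom.commutes, AlgEquiv.commutes, hι, hg, map_neg, mul_add,
        add_mul]
      rw [Algebra.commutes p j, ← mul_assoc, ← Algebra.commutes q j, mul_assoc, hij]
      simp [mul_assoc]

end Dec

end BrauerGroup

/-! ### Symmetric units inducing Galois automorphisms. -/

section Symmetric

variable {F M B : Type*} [Field F] [Field M] [Algebra F M] [FiniteDimensional F M] [Ring B]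
  [Algebra F B] [Algebra.IsCentral F B] [IsSimpleRing B] [FiniteDimensional F B]

/-- Elements inducing an involutive automorphism on a self-centralizing subfield can be chosen
symmetric. -/
theorem exists_symmetric_unit_mul_eq_gal (ι : M →ₐ[F] B)
    (hι : ∀ b, (∀ m, b * ι m = ι m * b) → ∃ m, b = ι m)
    {σ : B →ₗ[F] B} (hmul : ∀ x y, σ (x * y) = σ y * σ x) (hσ : ∀ m, σ (ι m) = ι m)
    (hσσ : ∀ x, σ (σ x) = x) (g : Gal(M/F)) (hg : ∀ m, g (g m) = m) {γ : M} (hγ : γ ≠ 0)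
    (hgγ : g γ = -γ) : ∃ w : Bˣ, (∀ m, w * ι m = ι (g m) * w) ∧ σ w = w := by
  obtain ⟨u, hu⟩ := exists_unit_mul_eq_gal ι g
  have hunit : ∀ m : M, m ≠ 0 → IsUnit (ι m) := fun m hm => (IsUnit.mk0 m hm).map ι
  have hu' : ∀ m, ↑u⁻¹ * ι (g m) = ι m * ↑u⁻¹ := fun m => by
    rw [Units.inv_mul_eq_iff_eq_mul, ← mul_assoc, hu, mul_assoc, Units.mul_inv, mul_one]
  obtain ⟨p, hp⟩ := hι (σ u * ↑u⁻¹) fun m => by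
    obtain ⟨m, rfl⟩ := g.surjective m
    have := congr_arg σ (hu (g m))
    rw [hmul, hmul, hσ, hσ, hg] at this
    rw [mul_assoc, hu', ← mul_assoc, ← mul_assoc, ← this]
  have hp' : σ u = ι p * u := by rw [← hp, mul_assoc, Units.inv_mul, mul_one]
  have key : ∀ q : M, q ≠ 0 → σ (ι q * u) = ι q * u →
      ∃ w : Bˣ, (∀ m, w * ι m = ι (g m) * w) ∧ σ w = w := by
    intro q hq h
    obtain ⟨w, hw⟩ := (hunit q hq).mul u.isUnit
    refine ⟨w, fun m => ?_, by rw [hw, h]⟩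
    rw [hw, mul_assoc, hu, ← mul_assoc, ← map_mul, mul_comm q, map_mul, mul_assoc]
  -- `u + σ u = (1 + p) u` is symmetric and serves unless it is zero. In that case `u` is skew, and
  -- multiplying by `γ`, which `g` negates, makes it symmetric.
  by_cases h : 1 + p = 0
  · refine key γ hγ ?_
    have : p = -1 := by linear_combination h
    rw [hmul, hσ, hp', this, mul_assoc, hu, hgγ]
    simp
  · refine key (1 + p) h ?_
    rw [map_add, map_one, add_mul, one_mul, map_add, ← hp', hσσ, add_comm]

end Symmetric

/-! ### Kummer theory of biquadratic extensions. -/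

section Biquadratic

variable {K M : Type*} [Field K] [Field M] [Algebra K M] {s : Fin 2 → M} {d : Fin 2 → K}

theorem exists_gal_generators_of_biquadratic (h2 : (2 : K) ≠ 0) (hd : ∀ i, d i ≠ 0)
    (hs : ∀ i, s i ^ 2 = algebraMap K M (d i))
    (htop : IntermediateField.adjoin K (Set.range s) = ⊤) (hdeg : Module.finrank K M = 2 ^ 2) :
    ∃ u v : Gal(M/K), u (s 0) = s 0 ∧ u (s 1) = -s 1 ∧ v (s 0) = -s 0 ∧ v (s 1) = s 1 ∧
      ∀ x, u x = x → v x = x → x ∈ Set.range (algebraMap K M) := by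
  have hF : FiniteDimensional K M := .of_finrank_pos (by omega)
  have hG := isGalois_of_adjoin_sqrt h2 hd hs htop
  obtain ⟨u, hu⟩ := exists_gal_of_signs h2 hd hs htop hdeg ![false, true]
  obtain ⟨v, hv⟩ := exists_gal_of_signs h2 hd hs htop hdeg ![true, false]
  have hu0 : u (s 0) = s 0 := by simpa using hu 0
  have hu1 : u (s 1) = -s 1 := by simpa using hu 1
  have hv0 : v (s 0) = -s 0 := by simpa using hv 0
  have hv1 : v (s 1) = s 1 := by simpa using hv 1
  refine ⟨u, v, hu0, hu1, hv0, hv1, fun x hux hvx => ?_⟩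
  rw [IsGalois.mem_range_algebraMap_iff_fixed]
  intro g
  rcases gal_apply_eq_or_eq_neg g (hs 0) with h0 | h0 <;>
    rcases gal_apply_eq_or_eq_neg g (hs 1) with h1 | h1
  · have : g = 1 := gal_ext_of_adjoin htop fun i => by fin_cases i <;> simp [h0, h1]
    rw [this]; rfl
  · have : g = u := gal_ext_of_adjoin htop fun i => by
      fin_cases i <;> simp [h0, h1, hu0, hu1]
    rw [this, hux]
  · have : g = v := gal_ext_of_adjoin htop fun i => by
      fin_cases i <;> simp [h0, h1, hv0, hv1]
    rw [this, hvx]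
  · have : g = u * v := gal_ext_of_adjoin htop fun i => by
      fin_cases i <;> simp [h0, h1, hu0, hu1, hv0, hv1]
    rw [this, AlgEquiv.mul_apply, hvx, hux]

/-- Kummer theory for a biquadratic extension. -/
theorem exists_eq_sq_mul_of_biquadratic (h2 : (2 : K) ≠ 0) (hd : ∀ i, d i ≠ 0)
    (hs : ∀ i, s i ^ 2 = algebraMap K M (d i))
    (htop : IntermediateField.adjoin K (Set.range s) = ⊤) (hdeg : Module.finrank K M = 2 ^ 2)
    {e : K} {δ : M} (hδ : δ ^ 2 = algebraMap K M e) :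
    ∃ (k : K) (i j : ℕ), e = k ^ 2 * (d 0 ^ i * d 1 ^ j) := by
  obtain ⟨u, v, hu0, hu1, hv0, hv1, hfix⟩ :=
    exists_gal_generators_of_biquadratic h2 hd hs htop hdeg
  have hs0 : ∀ i, s i ≠ 0 := fun i h => hd i (by
    have := hs i
    rwa [h, zero_pow two_ne_zero, eq_comm, map_eq_zero] at this)
  -- The exponents record the signs by which `u` and `v` act on `δ`. Since `u` negates only `s 1`
  -- and `v` only `s 0`, dividing `δ` by `s 0 ^ i * s 1 ^ j` gives an invariant element.
  obtain ⟨j, hj⟩ : ∃ j : ℕ, u δ = (-1) ^ j * δ := by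
    rcases gal_apply_eq_or_eq_neg u hδ with h | h
    exacts [⟨0, by simp [h]⟩, ⟨1, by simp [h]⟩]
  obtain ⟨i, hi⟩ : ∃ i : ℕ, v δ = (-1) ^ i * δ := by
    rcases gal_apply_eq_or_eq_neg v hδ with h | h
    exacts [⟨0, by simp [h]⟩, ⟨1, by simp [h]⟩]
  have hne : ∀ n : ℕ, ((-1) ^ n : M) ≠ 0 := fun n => pow_ne_zero n (by simp)
  have h3 := pow_ne_zero i (hs0 0)
  have h4 := pow_ne_zero j (hs0 1)
  obtain ⟨k, hk⟩ := hfix (δ / (s 0 ^ i * s 1 ^ j))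
    (by
      rw [map_div₀, map_mul, map_pow, map_pow, hu0, hu1, hj, neg_pow (s 1)]
      have := hne j
      field_simp)
    (by
      rw [map_div₀, map_mul, map_pow, map_pow, hv0, hv1, hi, neg_pow (s 0)]
      have := hne i
      field_simp)
  refine ⟨k, i, j, (algebraMap K M).injective ?_⟩
  rw [map_mul, map_mul, map_pow, map_pow, map_pow, ← hs, ← hs, hk, ← hδ]
  field_simp
  ring

end Biquadratic

/-! ### Exponent-two classes: unitary restriction and the biquadratic case. -/

namespace BrauerGroup

section Quadratic

variable {F K : Type*} [Field F] [Field K] [Algebra F K]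

theorem gal_gal_apply_of_unique {ψ : Gal(K/F)} (hψ1 : ψ ≠ 1)
    (hψ : ∀ φ : Gal(K/F), φ ≠ 1 → φ = ψ) (x : K) : ψ (ψ x) = x := by
  by_cases h : ψ * ψ = 1
  · exact congr($h x)
  · have := hψ _ h
    simp at this
    exact absurd this hψ1

theorem exists_ne_zero_gal_eq_neg {ψ : Gal(K/F)} (hψ1 : ψ ≠ 1)
    (hψ : ∀ φ : Gal(K/F), φ ≠ 1 → φ = ψ) : ∃ α : K, α ≠ 0 ∧ ψ α = -α := by
  obtain ⟨θ, hθ⟩ : ∃ θ, ψ θ ≠ θ := by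
    by_contra! h
    exact hψ1 (AlgEquiv.ext h)
  exact ⟨θ - ψ θ, sub_ne_zero.2 (Ne.symm hθ), by simp [gal_gal_apply_of_unique hψ1 hψ]⟩

end Quadratic

theorem nonempty_algEquiv_op {F : Type u} [Field F] {B : CSA.{u, u} F} (h : cls B ^ 2 = 1) :
    Nonempty (B ≃ₐ[F] (B : Type u)ᵐᵒᵖ) := by
  have h1 : cls B = cls (opp B) := by
    rw [cls_opp, eq_inv_iff_mul_eq_one, ← sq, h]
  exact nonempty_algEquiv_of_cls_eq h1 (MulOpposite.opLinearEquiv F (M := B)).finrank_eq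

/-- A class of exponent two split by a multiquadratic extension becomes unitary. -/
theorem res_mem_unitaryBr {F K M : Type u} [Field F] [Field K] [Field M] [Algebra F K]
    [Algebra F M] [Algebra.IsQuadraticExtension F K] [IsGalois F K] [IsGalois F M]
    [FiniteDimensional F M] (hgal : ∀ g : Gal(M/F), ∀ m, g (g m) = m)
    {x : BrauerGroup.{u, u} F} (hx : x ∈ relBr2 F M) : res F K x ∈ unitaryBr F K := by
  obtain ⟨hx1, hx2⟩ := hx
  obtain ⟨B, ι, rfl, hB, hι⟩ := exists_selfCentralizing hx1
  obtain ⟨e⟩ := nonempty_algEquiv_op hx2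
  obtain ⟨σ, h1, hmul, hσ, hσσ⟩ := exists_involution_of_algEquiv_op hgal ι hι e
  obtain ⟨ψ, hψ1, hψ⟩ := exists_gal_ne_one (F := F) (K := K)
  have hψψ := gal_gal_apply_of_unique hψ1 hψ
  -- Conjugation on `K` tensored with the involution of the first kind on `B` is unitary.
  let ρ : K ⊗[F] B →ₗ[F] K ⊗[F] B := TensorProduct.map ψ.toLinearMap σ
  have hρ : ∀ k b, ρ (k ⊗ₜ b) = ψ k ⊗ₜ σ b := fun _ _ => rfl
  refine ⟨baseChange F K B, rfl, ρ,
    .of_apply_algebraMap (A := baseChange F K B) hψ1 hψ ρ.map_add ?_ ?_ ?_⟩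
  · intro x y
    change K ⊗[F] B at x
    change K ⊗[F] B at y
    change ρ (x * y) = ρ y * ρ x
    induction x with
    | zero => simp
    | add x x' hx hx' => rw [add_mul, _root_.map_add, hx, hx', _root_.map_add, mul_add]
    | tmul a b =>
      induction y with
      | zero => simp
      | add y y' hy hy' => rw [mul_add, _root_.map_add, hy, hy', _root_.map_add, add_mul]
      | tmul a' b' =>
        simp only [Algebra.TensorProduct.tmul_mul_tmul, hρ, hmul, map_mul, mul_comm (ψ a)]
  · intro x
    change K ⊗[F] B at x
    change ρ (ρ x) = x
    induction x with
    | zero => simp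
    | add x x' hx hx' => rw [_root_.map_add, _root_.map_add, hx, hx']
    | tmul a b => rw [hρ, hρ, hψψ, hσσ]
  · intro k
    change ρ (k ⊗ₜ 1) = ψ k ⊗ₜ 1
    rw [hρ, h1]

/-- For a biquadratic extension `M/K`, the group `Br₂(M/K)` is generated by quaternion algebras
with a slot in the square classes that become trivial in `M`. -/
theorem relBr2_le_Dec_of_biquadratic {K M : Type u} [Field K] [Field M] [Algebra K M]
    (h2 : (2 : K) ≠ 0) (s : Fin 2 → M) (d : Fin 2 → K) (hd : ∀ i, d i ≠ 0)
    (hs : ∀ i, s i ^ 2 = algebraMap K M (d i))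
    (htop : IntermediateField.adjoin K (Set.range s) = ⊤) (hdeg : Module.finrank K M = 2 ^ 2) :
    relBr2 K M ≤ Dec K M := by
  rintro y ⟨hy1, hy2⟩
  have hF : FiniteDimensional K M := .of_finrank_pos (by omega)
  have hG := isGalois_of_adjoin_sqrt h2 hd hs htop
  have hgal := gal_gal_apply hs htop
  obtain ⟨B, ι, rfl, hB, hι⟩ := exists_selfCentralizing hy1
  obtain ⟨e⟩ := nonempty_algEquiv_op hy2
  obtain ⟨σ, h1, hmul, hσ, hσσ⟩ := exists_involution_of_algEquiv_op hgal ι hι e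
  have hιinj : Function.Injective ι := ι.toRingHom.injective
  have hs0 : ∀ i, s i ≠ 0 := fun i h => hd i (by
    have := hs i
    rwa [h, zero_pow two_ne_zero, eq_comm, map_eq_zero] at this)
  obtain ⟨u, v, hu0, hu1, hv0, hv1, hfix⟩ :=
    exists_gal_generators_of_biquadratic h2 hd hs htop hdeg
  have huv : ∀ x, v (u x) = u (v x) := by
    have : v * u = u * v := gal_ext_of_adjoin htop fun i => by
      fin_cases i <;> simp [hu0, hu1, hv0, hv1]
    exact fun x => congr($this x)
  obtain ⟨U, hU, hσU⟩ :=
    exists_symmetric_unit_mul_eq_gal ι hι hmul hσ hσσ u (hgal u) (hs0 1) hu1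
  obtain ⟨V, hV, hσV⟩ :=
    exists_symmetric_unit_mul_eq_gal ι hι hmul hσ hσσ v (hgal v) (hs0 0) hv0
  -- `U V` and `V U` induce the same automorphism, so they differ by an element of `M`.
  obtain ⟨w, hw⟩ := hι (V * U * ↑(U * V)⁻¹) fun m => by
    obtain ⟨m, rfl⟩ := u.surjective m
    obtain ⟨m, rfl⟩ := v.surjective m
    have h3 : ↑(U * V)⁻¹ * ι (u (v m)) = ι m * ↑(U * V)⁻¹ := by
      rw [Units.inv_mul_eq_iff_eq_mul, Units.val_mul, mul_assoc, ← mul_assoc (V : B), hV,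
        mul_assoc, ← mul_assoc, hU, mul_assoc, ← mul_assoc (U : B), ← Units.val_mul,
        Units.mul_inv, mul_one]
    rw [mul_assoc, h3, mul_assoc, ← mul_assoc (U : B), hU, ← mul_assoc, ← mul_assoc, hV, huv]
    simp only [mul_assoc]
  have hVU : (V : B) * U = ι w * (U * V) := by
    rw [← hw, ← Units.val_mul U V, Units.inv_mul_cancel_right]
  -- `σ` fixes `U` and `V` and reverses products; applied to `V U = w U V`, it yields this norm
  -- condition.
  have hw1 : w * u (v w) = 1 := by
    have h3 := congr_arg σ hVU
    rw [hmul, hmul, hmul, hσ, hσU, hσV, mul_assoc, hU, ← mul_assoc, hV, huv, mul_assoc, hVU,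
      ← mul_assoc, ← map_mul] at h3
    have h4 : ι (u (v w) * w) * ↑(U * V) = 1 * ↑(U * V) := by
      rw [one_mul, Units.val_mul, ← h3]
    rw [(U * V).isUnit.mul_left_inj, ← map_one ι, hιinj.eq_iff] at h4
    rw [mul_comm, h4]
  have hw0 : w ≠ 0 := left_ne_zero_of_mul_eq_one hw1
  -- Hilbert 90 for the involution `u ∘ v`: `1 + w` works unless it vanishes, and then `s 0` does,
  -- as `u ∘ v` negates it.
  obtain ⟨p, hp0, hp⟩ : ∃ p : M, p ≠ 0 ∧ u (v p) * w = p := by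
    by_cases h : 1 + w = 0
    · refine ⟨s 0, hs0 0, ?_⟩
      rw [hv0, map_neg, hu0]
      linear_combination (-(s 0)) * h
    · refine ⟨1 + w, h, ?_⟩
      rw [map_add, map_one, map_add, map_one]
      linear_combination hw1
  obtain ⟨z, hz⟩ := hι (U * U) fun m => by
    rw [mul_assoc, hU, ← mul_assoc, hU, hgal, mul_assoc]
  -- This rescaling makes the square of `U'` commute with `V` as well, even though `U'` itself need
  -- not. So the square is fixed by `u` and `v` and lies in `K`, and `s 1` and `U'` generate a
  -- quaternion subalgebra.
  obtain ⟨U', hU'⟩ : IsUnit (ι (u p) * U) :=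
    (((IsUnit.mk0 p hp0).map u).map ι).mul U.isUnit
  have hU'm : ∀ m, U' * ι m = ι (u m) * U' := fun m => by
    rw [hU', mul_assoc, hU, ← mul_assoc, ← map_mul, mul_comm (u p), map_mul, mul_assoc]
  have hVU' : (V : B) * U' = ι p * (U * V) := by
    rw [hU', ← mul_assoc, hV, mul_assoc, hVU, ← mul_assoc, ← map_mul, huv, hp]
  have hU'2 : (U' : B) * U' = ι (p * u p * z) := by
    conv_lhs => arg 2; rw [hU']
    rw [← mul_assoc, hU'm, hgal, hU', mul_assoc, mul_assoc, hz, ← map_mul, ← map_mul, mul_assoc]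
  obtain ⟨k, hk⟩ := hfix (p * u p * z) (by
      have h3 : U' * (U' * U' : B) = (U' * U') * U' := (mul_assoc ..).symm
      rw [hU'2, hU'm] at h3
      exact hιinj (U'.isUnit.mul_left_inj.1 h3)) (by
      have h3 : V * (U' * U' : B) = (U' * U') * V := by
        rw [← mul_assoc, hVU', hU'2]
        have : (ι p * (U * V) * U' : B) = ι p * (U * (V * U')) := by simp only [mul_assoc]
        rw [this, hVU', ← mul_assoc (U : B), hU, mul_assoc (ι (u p)), ← mul_assoc (U : B) U V, hz]
        simp only [map_mul, mul_assoc]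
      rw [hU'2, hV] at h3
      exact hιinj (V.isUnit.mul_left_inj.1 h3))
  rw [← hk, AlgHom.commutes] at hU'2
  have hk0 : k ≠ 0 := by
    rintro rfl
    rw [map_zero] at hU'2
    exact (U' * U').ne_zero (by rw [Units.val_mul, hU'2])
  obtain ⟨f, hfi, hfj, hf⟩ := exists_quaternionCSA_algHom h2 (hd 1) hk0 (i := ι (s 1)) (j := U')
    (by rw [← map_mul, ← sq, hs, AlgHom.commutes]) hU'2
    (by rw [hU'm, hu1, map_neg, neg_mul])
  have c1 := isSimpleRing_centralizer f
  have c2 := isCentral_centralizer f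
  have c3 := finrank_mul_finrank_centralizer f
  rw [finrank_quaternionCSA, hB, hdeg] at c3
  let C := Subalgebra.centralizer K (f.range : Set B)
  have hcls : quat h2 (hd 1) hk0 * cls (csaOf K C) = cls B := by
    rw [quat, ← cls_tensor]
    exact cls_eq_of_algEquiv (A := tensor (quaternionCSA h2 (hd 1) hk0) (csaOf K C)) (B := B)
      (AlgEquiv.ofBijective _ (mulCentralizer_bijective f))
  -- `L` is generated by `s 0`. It commutes with `s 1` and with `U'`, so it embeds in the
  -- centralizer `C`, which has dimension four.
  let L : IntermediateField K M := IntermediateField.fixedField (Subgroup.zpowers u)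
  have hL : ∀ m, m ∈ L ↔ u m = m := fun m => by
    rw [IntermediateField.mem_fixedField_iff]
    refine ⟨fun h => h u (Subgroup.mem_zpowers u), fun h g hg => ?_⟩
    obtain ⟨n, rfl⟩ := hg
    have : u ∈ MulAction.stabilizer Gal(M/K) m := h
    exact Subgroup.zpow_mem _ this n
  have hLdeg : Module.finrank K L = 2 := by
    have h3 : Module.finrank L M = 2 := by
      rw [IntermediateField.finrank_fixedField_eq_card, Nat.card_zpowers]
      refine orderOf_eq_prime (AlgEquiv.ext fun x => ?_) ?_
      · rw [sq]
        exact hgal u x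
      · rintro rfl
        have : 2 * s 1 = 0 := by
          rw [AlgEquiv.one_apply] at hu1
          linear_combination hu1
        exact mul_ne_zero (two_ne_zero_of_algebra h2) (hs0 1) this
    have h4 := Module.finrank_mul_finrank K L M
    rw [hdeg, h3] at h4
    omega
  let β : L := ⟨s 0, (hL _).2 hu0⟩
  have hβ : β ^ 2 = algebraMap K L (d 0) := Subtype.ext (hs 0)
  have hβK : β ∉ Set.range (algebraMap K L) := by
    rintro ⟨x, hx⟩
    have h3 : algebraMap K M x = s 0 := congr_arg Subtype.val hx
    have h4 := hv0
    rw [← h3, AlgEquiv.commutes, h3] at h4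
    have : 2 * s 0 = 0 := by linear_combination h4
    exact mul_ne_zero (two_ne_zero_of_algebra h2) (hs0 0) this
  obtain ⟨g, hg, hgg, hgfix⟩ := exists_gal_neg h2 hLdeg (hd 0) hβ
    (adjoin_eq_top_of_finrank_two hLdeg hβK)
  let ιL : L →ₐ[K] C := (ι.comp L.val).codRestrict C (by
    rintro m _ ⟨x, rfl⟩
    refine (hf (ι m) ?_ ?_ x).symm
    · rw [← map_mul, ← map_mul, mul_comm]
    · rw [hU'm, (hL m).1 m.2])
  obtain ⟨t, ht, hC⟩ := exists_eq_quat h2 (hd 0) hβ g hg hgg hgfix (B := csaOf K C)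
    (by
      have c4 : 4 * Module.finrank K C = (2 ^ 2) ^ 2 := c3
      change Module.finrank K C = 4
      omega) ιL (by
      intro c hc
      change C at c
      have hc0 : (c : B) * ι (s 0) = ι (s 0) * c := congr_arg Subtype.val (hc β)
      have hc1 : (c : B) * ι (s 1) = ι (s 1) * c := (c.2 _ hfi).symm
      -- An element of `C` commuting with `L` commutes with `s 0` and `s 1`, hence with `M`, and so
      -- lies in `M`. Commuting with `U'` it is fixed by `u`, so `L` is self-centralizing in `C`.
      have hcM : ∀ m ∈ IntermediateField.adjoin K (Set.range s), (c : B) * ι m = ι m * c := by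
        intro m hm
        induction hm using IntermediateField.adjoin_induction with
        | mem x hx =>
          obtain ⟨i, rfl⟩ := hx
          fin_cases i
          exacts [hc0, hc1]
        | algebraMap x => rw [AlgHom.commutes, Algebra.commutes]
        | add x y _ _ hx hy => rw [map_add, mul_add, add_mul, hx, hy]
        | inv x _ hx =>
          by_cases h0 : x = 0
          · simp [h0]
          · have hunit : IsUnit (ι x) := (IsUnit.mk0 x h0).map ι
            rw [← hunit.mul_right_inj, ← hunit.mul_left_inj]
            have h3 : ι x * ι x⁻¹ = 1 := by rw [← map_mul, mul_inv_cancel₀ h0, map_one]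
            have h4 : ι x⁻¹ * ι x = 1 := by rw [← map_mul, inv_mul_cancel₀ h0, map_one]
            rw [← mul_assoc, ← hx, mul_assoc, mul_assoc, h4, mul_one, ← mul_assoc, h3, one_mul, hx]
        | mul x y _ _ hx hy =>
          rw [map_mul, ← mul_assoc, hx, mul_assoc, hy, mul_assoc]
      obtain ⟨m, hm⟩ := hι c fun m => hcM m (by rw [htop]; trivial)
      have h3 := c.2 _ hfj
      rw [hm, hU'm] at h3
      refine ⟨⟨m, (hL m).2 (hιinj (U'.isUnit.mul_left_inj.1 h3))⟩, Subtype.ext hm⟩)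
  rw [← hcls, hC]
  exact mul_mem (quat_mem_closure_cyclicClasses h2 _ _ trivial (hs 1))
    (quat_mem_closure_cyclicClasses h2 _ _ trivial (hs 0))

end BrauerGroup

/-! ### Descent along a quadratic extension. -/

namespace BrauerGroup

section Descent

variable {F K : Type u} [Field F] [Field K] [Algebra F K]

/-- Galois descent along a quadratic extension, for algebras with an antiautomorphism. -/
theorem exists_descent [Algebra.IsQuadraticExtension F K] [IsGalois F K] (h2 : (2 : F) ≠ 0)
    {ψ : Gal(K/F)} (hψ1 : ψ ≠ 1) (hψ : ∀ φ : Gal(K/F), φ ≠ 1 → φ = ψ)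
    {C : CSA.{u, u} K} (Φ : C ≃+* C) (hΦ : ∀ k, Φ (algebraMap K C k) = algebraMap K C (ψ k))
    (hΦΦ : ∀ x, Φ (Φ x) = x) (S : C →ₗ[K] C) (hS1 : S 1 = 1)
    (hSmul : ∀ x y, S (x * y) = S y * S x) (hSΦ : ∀ x, S (Φ x) = Φ (S x)) :
    ∃ x : BrauerGroup.{u, u} F, res F K x = cls C ∧ x ^ 2 = 1 := by
  have h2K : (2 : K) ≠ 0 := two_ne_zero_of_algebra h2
  have hψψ := gal_gal_apply_of_unique hψ1 hψ
  have hψfix := gal_fixed_iff hψ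
  obtain ⟨α, hα0, hψα⟩ := exists_ne_zero_gal_eq_neg hψ1 hψ
  let _ : Algebra F C := Algebra.compHom C (algebraMap F K)
  have : IsScalarTower F K C := .of_algebraMap_eq fun _ => rfl
  have hFC : ∀ r : F, algebraMap F C r = algebraMap K C (algebraMap F K r) := fun _ => rfl
  have : FiniteDimensional F C := FiniteDimensional.trans F K C
  have hΦsmul : ∀ (k : K) (x : C), Φ (k • x) = ψ k • Φ x := fun k x => by
    rw [Algebra.smul_def, map_mul, hΦ, ← Algebra.smul_def]
  -- The fixed ring of `Φ` is the descended algebra. Halving `x ± Φ x`, with the odd part divided by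
  -- the anti-invariant `α`, writes every element of `C` through `A`.
  let A : Subalgebra F C :=
    { carrier := {x | Φ x = x}
      mul_mem' := fun {x y} hx hy => by
        change Φ _ = _; rw [map_mul, hx, hy]
      add_mem' := fun {x y} hx hy => by
        change Φ _ = _; rw [map_add, hx, hy]
      algebraMap_mem' := fun r => by
        change Φ _ = _; rw [hFC, hΦ, AlgEquiv.commutes] }
  have hA : ∀ a : A, Φ a = a := fun a => a.2
  let μ : K ⊗[F] A →ₐ[K] C :=
    Algebra.TensorProduct.lift (Algebra.ofId K C) A.val fun k a => Algebra.commutes k (a : C)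
  have hμ : ∀ k (a : A), μ (k ⊗ₜ a) = k • (a : C) := fun k a => by
    refine (Algebra.TensorProduct.lift_tmul ..).trans ?_
    rw [Algebra.smul_def]
    rfl
  have hsurj : Function.Surjective μ := by
    intro x
    let a : A := ⟨(2⁻¹ : K) • (x + Φ x), by
      change Φ _ = _
      rw [hΦsmul, map_add, hΦΦ, map_inv₀, map_ofNat, add_comm]⟩
    let b : A := ⟨(2 * α)⁻¹ • (x - Φ x), by
      change Φ _ = _
      rw [hΦsmul, map_sub, hΦΦ, map_inv₀, map_mul, map_ofNat, hψα, mul_neg, inv_neg, neg_smul,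
        ← smul_neg, neg_sub]⟩
    refine ⟨1 ⊗ₜ a + α ⊗ₜ b, ?_⟩
    rw [map_add, hμ, hμ, one_smul]
    change (2⁻¹ : K) • (x + Φ x) + α • (2 * α)⁻¹ • (x - Φ x) = x
    have h3 : α * (2 * α)⁻¹ = 2⁻¹ := by field_simp
    rw [smul_smul, h3, ← smul_add, add_add_sub_cancel, ← two_smul K, smul_smul, inv_mul_cancel₀ h2K,
      one_smul]
  have hinj : Function.Injective μ := by
    rw [injective_iff_map_eq_zero]
    intro t ht
    obtain ⟨a, b, rfl⟩ : ∃ a b : A, t = 1 ⊗ₜ a + α ⊗ₜ b := by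
      clear ht
      induction t with
      | zero => exact ⟨0, 0, by simp⟩
      | add s t hs ht =>
        obtain ⟨a, b, rfl⟩ := hs
        obtain ⟨a', b', rfl⟩ := ht
        exact ⟨a + a', b + b', by simp only [TensorProduct.tmul_add]; abel⟩
      | tmul k a =>
        obtain ⟨p, q, rfl⟩ := exists_eq_add_mul_sqrt h2 hα0 hψα hψψ (fun x hx => (hψfix x).1 hx) k
        refine ⟨p • a, q • a, ?_⟩
        rw [TensorProduct.add_tmul, ← TensorProduct.smul_tmul, ← TensorProduct.smul_tmul,
          ← Algebra.smul_def, Algebra.algebraMap_eq_smul_one]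
    rw [map_add, hμ, hμ, one_smul] at ht
    have ht' := congr_arg Φ ht
    rw [map_add, hΦsmul, map_zero, hA, hA, hψα, neg_smul] at ht'
    have ha : (a : C) = 0 := by
      have : (2 : K) • (a : C) = 0 := by
        rw [two_smul]
        calc (a : C) + a = (a + α • (b : C)) + (a + -(α • (b : C))) := by abel
          _ = 0 := by rw [ht, ht', add_zero]
      exact (smul_eq_zero.1 this).resolve_left h2K
    rw [ha, zero_add] at ht
    have hb : (b : C) = 0 := (smul_eq_zero.1 ht).resolve_left hα0
    rw [show a = 0 from Subtype.ext ha, show b = 0 from Subtype.ext hb]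
    simp
  let e := AlgEquiv.ofBijective μ ⟨hinj, hsurj⟩
  have s1 : IsSimpleRing (K ⊗[F] A) := .of_ringEquiv e.symm.toRingEquiv inferInstance
  have s2 : IsSimpleRing A := isSimpleRing_of_tensorProduct_right F K A
  have s3 : Algebra.IsCentral F A := by
    refine ⟨fun x hx => ?_⟩
    rw [Subalgebra.mem_center_iff] at hx
    have hxC : (x : C) ∈ Subalgebra.center K C := by
      rw [Subalgebra.mem_center_iff]
      intro y
      obtain ⟨t, rfl⟩ := hsurj y
      induction t with
      | zero => simp
      | add s t hs ht => rw [map_add, add_mul, mul_add, hs, ht]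
      | tmul k a =>
        rw [hμ, smul_mul_assoc, mul_smul_comm]
        congr 1
        exact congr_arg Subtype.val (hx a)
    obtain ⟨k, hk⟩ := (Algebra.IsCentral.mem_center_iff K).1 hxC
    have h3 := hA x
    rw [hk, hΦ, (algebraMap K C).injective.eq_iff, hψfix] at h3
    obtain ⟨r, rfl⟩ := h3
    exact ⟨r, Subtype.ext hk.symm⟩
  -- Since `S` commutes with `Φ`, it preserves the fixed ring; its restriction gives `A ≅ Aᵐᵒᵖ` and
  -- hence exponent two.
  let T : A →ₗ[F] A :=
    { toFun := fun a => ⟨S a, by change Φ _ = _; rw [← hSΦ, hA]⟩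
      map_add' := fun a b => Subtype.ext (map_add S (a : C) b)
      map_smul' := fun r a => Subtype.ext (by
        change S (algebraMap F K r • (a : C)) = algebraMap F K r • S a
        exact map_smul S _ _) }
  have hT : ∀ a : A, ((T a : A) : C) = S a := fun _ => rfl
  let f : A →ₐ[F] Aᵐᵒᵖ := AlgHom.ofLinearMap
    ((MulOpposite.opLinearEquiv F (M := A)).toLinearMap ∘ₗ T)
    (MulOpposite.unop_injective (Subtype.ext hS1)) fun x y =>
      MulOpposite.unop_injective (Subtype.ext (hSmul x y))
  have hf1 : Function.Injective f := f.toRingHom.injective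
  have hf2 : Function.Surjective f :=
    (LinearMap.injective_iff_surjective_of_finrank_eq_finrank (f := f.toLinearMap)
      (MulOpposite.opLinearEquiv F (M := A)).finrank_eq).1 hf1
  refine ⟨cls (csaOf F A), cls_eq_of_algEquiv (A := baseChange F K (csaOf F A)) (B := C) e, ?_⟩
  have h3 : cls (csaOf F A) = cls (opp (csaOf F A)) :=
    cls_eq_of_algEquiv (A := csaOf F A) (B := opp (csaOf F A)) (AlgEquiv.ofBijective f ⟨hf1, hf2⟩)
  rw [cls_opp, eq_inv_iff_mul_eq_one] at h3
  rw [sq, h3]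

end Descent

end BrauerGroup

/-! ### Descent from a semilinear automorphism whose square is inner. -/

namespace BrauerGroup

section Descent

variable {F K : Type u} [Field F] [Field K] [Algebra F K]

/-- An algebra with an involution of the first kind and a semilinear automorphism inverted by
it descends to a class of exponent two. -/
theorem exists_descent_of_semilinear [Algebra.IsQuadraticExtension F K] [IsGalois F K]
    {M : Type u} [Field M] [Algebra K M] (h2 : (2 : F) ≠ 0) {ψ : Gal(K/F)} (hψ1 : ψ ≠ 1)
    (hψ : ∀ φ : Gal(K/F), φ ≠ 1 → φ = ψ) {ψM : M ≃+* M}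
    (hψM : ∀ k, ψM (algebraMap K M k) = algebraMap K M (ψ k)) (hψMM : ∀ m, ψM (ψM m) = m)
    {B : CSA.{u, u} K} (ι : M →ₐ[K] B) (hι : ∀ b, (∀ m, b * ι m = ι m * b) → ∃ m, b = ι m)
    {σ : B →ₗ[K] B} (h1 : σ 1 = 1) (hmul : ∀ x y, σ (x * y) = σ y * σ x)
    (hσ : ∀ m, σ (ι m) = ι m)
    (φ : B ≃+* B) (hφ : ∀ m, φ (ι m) = ι (ψM m)) (hφσ : ∀ x, φ (σ (φ x)) = σ x) :
    ∃ x : BrauerGroup.{u, u} F, res F K x = cls B ∧ x ^ 2 = 1 := by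
  have hψψ := gal_gal_apply_of_unique hψ1 hψ
  have hφK : ∀ k, φ (algebraMap K B k) = algebraMap K B (ψ k) := fun k => by
    rw [← AlgHom.commutes ι, hφ, hψM, AlgHom.commutes]
  have hιinj : Function.Injective ι := ι.toRingHom.injective
  have hιinv : ∀ m : M, m ≠ 0 → ι m * ι m⁻¹ = 1 := fun m hm => by
    rw [← map_mul, mul_inv_cancel₀ hm, map_one]
  have hιinv' : ∀ m : M, m ≠ 0 → ι m⁻¹ * ι m = 1 := fun m hm => by
    rw [← map_mul, inv_mul_cancel₀ hm, map_one]
  -- `φ²` is `K`-linear and trivial on `M`, so it is conjugation by an element of `M`, determined up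
  -- to scalars in `K`. The scalar freedom makes it invariant under `ψM`.
  obtain ⟨d, hd0, hdψ, hdφ⟩ : ∃ d : M, d ≠ 0 ∧ ψM d = d ∧ ∀ x, ι d * φ (φ x) = x * ι d := by
    let f : B →ₐ[K] B :=
      { (φ.trans φ).toRingHom with
        commutes' := fun k => by
          change φ (φ _) = _
          rw [hφK, hφK, hψψ] }
    have hf : ∀ x, f x = φ (φ x) := fun _ => rfl
    obtain ⟨w, hw⟩ := skolem_noether f (AlgHom.id K B)
    have hw' : ∀ x, w * φ (φ x) = x * w := fun x => by
      have : x = w * f x * ↑w⁻¹ := hw x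
      conv_rhs => rw [this]
      rw [mul_assoc, Units.inv_mul, mul_one, hf]
    obtain ⟨d, hd⟩ := hι w fun m => by rw [← hw', hφ, hφ, hψMM]
    have hd0 : d ≠ 0 := by
      rintro rfl
      rw [map_zero] at hd
      exact w.ne_zero hd
    rw [hd] at hw'
    -- Both `d` and its conjugate `ψM d` induce `φ²`, because `φ` commutes with its own square;
    -- hence their quotient is central.
    obtain ⟨l, hl⟩ : ∃ l : K, ι (ψM d * d⁻¹) = algebraMap K B l := by
      apply (Algebra.IsCentral.mem_center_iff K).1
      rw [Subalgebra.mem_center_iff]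
      intro x
      obtain ⟨y, rfl⟩ := φ.surjective x
      have h3 := congr_arg φ (hw' y)
      rw [map_mul, map_mul, hφ] at h3
      have h4 := hw' (φ y)
      have h5 : ι d⁻¹ * φ y = φ (φ (φ y)) * ι d⁻¹ := by
        calc ι d⁻¹ * φ y = ι d⁻¹ * (φ y * ι d) * ι d⁻¹ := by
              rw [mul_assoc, mul_assoc, hιinv d hd0, mul_one]
          _ = _ := by rw [← h4, ← mul_assoc, hιinv' d hd0, one_mul]
      rw [map_mul, mul_assoc, h5, ← mul_assoc, ← mul_assoc, h3]
    rw [← AlgHom.commutes ι, hιinj.eq_iff, mul_inv_eq_iff_eq_mul₀ hd0] at hl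
    have hll : ψ l * l = 1 := by
      apply (algebraMap K M).injective
      have h3 := hψMM d
      rw [hl, map_mul, hψM, hl, ← mul_assoc, ← map_mul] at h3
      rw [map_one]
      exact mul_right_cancel₀ hd0 (by rw [h3, one_mul])
    -- Hilbert 90 for `K/F`, with an anti-invariant element replacing `1 + l` when the latter
    -- vanishes.
    obtain ⟨μ, hμ0, hμ⟩ : ∃ μ : K, μ ≠ 0 ∧ ψ μ * l = μ := by
      by_cases h : 1 + l = 0
      · obtain ⟨α, hα0, hα⟩ := exists_ne_zero_gal_eq_neg hψ1 hψ
        exact ⟨α, hα0, by rw [hα]; linear_combination (-α) * h⟩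
      · refine ⟨1 + l, h, ?_⟩
        rw [map_add, map_one]
        linear_combination hll
    refine ⟨algebraMap K M μ * d, mul_ne_zero ((map_ne_zero _).2 hμ0) hd0, ?_, fun x => ?_⟩
    · rw [map_mul, hψM, hl, ← mul_assoc, ← map_mul, hμ]
    · rw [map_mul, AlgHom.commutes, mul_assoc, hw', ← mul_assoc, Algebra.commutes, mul_assoc]
  have hDe := hιinv d hd0
  have heD := hιinv' d hd0
  have hφD : φ (ι d) = ι d := by rw [hφ, hdψ]
  have hφe : φ (ι d⁻¹) = ι d⁻¹ := by rw [hφ, map_inv₀, hdψ]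
  have hσD := hσ d
  have hσe := hσ d⁻¹
  have hcD : ∀ x, ι d * (ι d⁻¹ * x) = x := fun x => by rw [← mul_assoc, hDe, one_mul]
  have hce : ∀ x, ι d⁻¹ * (ι d * x) = x := fun x => by rw [← mul_assoc, heD, one_mul]
  generalize ι d = D at hDe heD hφD hφe hσD hσe hcD hce hdφ
  generalize ι d⁻¹ = e at hDe heD hφD hφe hσD hσe hcD hce hdφ
  have hφφ : ∀ x, φ (φ x) = e * (x * D) := fun x => by rw [← hdφ, hce]
  have hφσ' : ∀ x, φ (σ x) = e * (σ (φ x) * D) := by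
    intro x
    obtain ⟨z, rfl⟩ := φ.surjective x
    rw [hφσ, hφφ, hmul, hmul, hσD, hσe]
    simp only [mul_assoc, heD, mul_one, hce]
  -- `J² = D` and `J` is fixed entrywise by `φ`. Conjugation by `J` after `φ` therefore squares to
  -- conjugation by `D` after `φ²`, which is the identity.
  let J : (Matrix (Fin 2) (Fin 2) B)ˣ :=
    ⟨!![0, 1; D, 0], !![0, e; 1, 0],
      by ext i j; fin_cases i <;> fin_cases j <;> simp [Matrix.mul_apply, Fin.sum_univ_two, hDe],
      by ext i j; fin_cases i <;> fin_cases j <;> simp [Matrix.mul_apply, Fin.sum_univ_two, heD]⟩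
  let Φ : Matrix (Fin 2) (Fin 2) B ≃+* Matrix (Fin 2) (Fin 2) B :=
    φ.mapMatrix.trans (innerAut J)
  have hΦ : ∀ X, Φ X = !![φ (X 1 1), φ (X 1 0) * e; D * φ (X 0 1), D * φ (X 0 0) * e] := by
    intro X
    change !![0, 1; D, 0] * X.map φ * !![0, e; 1, 0] = _
    ext i j
    fin_cases i <;> fin_cases j <;>
      simp [Matrix.mul_apply, Fin.sum_univ_two, Matrix.vecMul, dotProduct]
  have hΦΦ : ∀ X, Φ (Φ X) = X := by
    intro X
    rw [hΦ, hΦ]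
    ext i j
    fin_cases i <;> fin_cases j <;> simp [hφφ, hφD, hφe, mul_assoc, hcD, hDe]
  -- The `σ`-transpose conjugated by `diag(1, D)`; this twist is what makes it commute with `Φ`.
  let S : Matrix (Fin 2) (Fin 2) B →ₗ[K] Matrix (Fin 2) (Fin 2) B :=
    { toFun := fun X => !![σ (X 0 0), σ (X 1 0) * e; D * σ (X 0 1), D * σ (X 1 1) * e]
      map_add' := fun X Y => by
        ext i j
        fin_cases i <;> fin_cases j <;> simp [mul_add, add_mul]
      map_smul' := fun k X => by
        ext i j
        fin_cases i <;> fin_cases j <;> simp }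
  have hS : ∀ X, S X = !![σ (X 0 0), σ (X 1 0) * e; D * σ (X 0 1), D * σ (X 1 1) * e] :=
    fun _ => rfl
  obtain ⟨x, hx, hx2⟩ := exists_descent h2 hψ1 hψ (C := csaOf K (Matrix (Fin 2) (Fin 2) B)) Φ
    (fun k => by
      change Φ (algebraMap K (Matrix (Fin 2) (Fin 2) B) k) =
        algebraMap K (Matrix (Fin 2) (Fin 2) B) (ψ k)
      rw [hΦ]
      ext i j
      fin_cases i <;> fin_cases j <;>
        simp [Matrix.algebraMap_matrix_apply, hφK, ← Algebra.commutes, mul_assoc, hDe])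
    hΦΦ S
    (by
      change S (1 : Matrix (Fin 2) (Fin 2) B) = (1 : Matrix (Fin 2) (Fin 2) B)
      rw [hS]
      ext i j
      fin_cases i <;> fin_cases j <;> simp [h1, hDe])
    (fun X Y => by
      change Matrix (Fin 2) (Fin 2) B at X
      change Matrix (Fin 2) (Fin 2) B at Y
      change S (X * Y) = S Y * S X
      simp only [hS]
      ext i j
      fin_cases i <;> fin_cases j <;>
        simp [Matrix.mul_apply, Fin.sum_univ_two, hmul, mul_assoc, hce, mul_add, add_mul])
    (fun X => by
      change Matrix (Fin 2) (Fin 2) B at X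
      change S (Φ X) = Φ (S X)
      rw [hS, hΦ, hΦ, hS]
      ext i j
      fin_cases i <;> fin_cases j <;>
        simp [hmul, hφσ', hσD, hσe, hφD, hφe, mul_assoc, hcD, hDe])
  exact ⟨x, hx.trans (cls_matrix B 2), hx2⟩

end Descent
end BrauerGroup

/-! ### Comparing involutions of the first kind with semilinear ones. -/

section Involutions

variable {K A : Type*} [Field K] [Ring A] [Algebra K A] [Algebra.IsCentral K A]

/-- Comparing a semilinear automorphism with the composite of an involution of the first kind and
a semilinear involution. -/
theorem exists_norm_mul_eq_one {ψ : K → K} {σ : A →ₗ[K] A} (hσ : ∀ x y, σ (x * y) = σ y * σ x)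
    (hσσ : ∀ x, σ (σ x) = x) {t : A → A} (htt : ∀ x, t (t x) = x) (φ : A ≃+* A)
    (hφ : ∀ k, φ (algebraMap K A k) = algebraMap K A (ψ k)) (w D : Aˣ)
    (hφt : ∀ x, φ x * w = w * σ (t x)) (hD : ∀ x, D * φ (σ (φ x)) = σ x * D) (hσD : σ D = D) :
    ∃ ρ : K, algebraMap K A (ρ * ψ ρ) * φ D * D = 1 := by
  -- Applying `σ` and then `φ` to `hφt` at `t y` gives a second intertwining relation between `φ`
  -- and `σ ∘ t`. Comparing it with the first shows that `φ (σ w)` is a central multiple `ρ` of `w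
  -- D`.
  have h1 : ∀ y, φ y * φ (σ w) = φ (σ w) * (↑D⁻¹ * (σ (t y) * D)) := fun y => by
    have h3 := congr_arg σ (hφt (t y))
    rw [htt, hσ, hσ, hσσ] at h3
    have h4 := congr_arg φ h3
    rw [map_mul, map_mul, ← hD, Units.inv_mul_cancel_left] at *
    exact h4.symm
  obtain ⟨ρ, hρ⟩ : ∃ ρ : K, ↑w⁻¹ * φ (σ w) * ↑D⁻¹ = algebraMap K A ρ := by
    apply (Algebra.IsCentral.mem_center_iff K).1
    rw [Subalgebra.mem_center_iff]
    intro z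
    have h3 := h1 (t (σ z))
    have h4 := hφt (t (σ z))
    rw [htt, hσσ] at h3 h4
    have h5 : φ (t (σ z)) = w * z * ↑w⁻¹ := by rw [← h4, Units.mul_inv_cancel_right]
    rw [h5] at h3
    calc z * (↑w⁻¹ * φ (σ w) * ↑D⁻¹) = ↑w⁻¹ * (w * z * ↑w⁻¹ * φ (σ w)) * ↑D⁻¹ := by
          simp only [mul_assoc, Units.inv_mul_cancel_left]
      _ = _ := by rw [h3]; simp only [mul_assoc, Units.mul_inv, mul_one]
  have h2 : φ (σ w) = algebraMap K A ρ * w * D := by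
    rw [Algebra.commutes, ← hρ]
    simp only [mul_assoc, Units.inv_mul, mul_one, Units.mul_inv_cancel_left]
  refine ⟨ρ, ?_⟩
  -- Applying `φ ∘ σ` a second time and using `hD` returns to `w`; the accumulated factors must
  -- cancel.
  have h3 := congr_arg (fun x => D * φ (σ x)) h2
  have hρσ : σ (algebraMap K A ρ * w * D) = D * σ w * algebraMap K A ρ := by
    rw [mul_assoc, ← Algebra.smul_def, map_smul, hσ, hσD, Algebra.smul_def, Algebra.commutes]
  rw [hD, hσσ, hρσ, map_mul, map_mul, hφ, h2] at h3
  have h4 : D * (φ D * algebraMap K A (ρ * ψ ρ)) * (w * D : A) = 1 * (w * D : A) := by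
    rw [one_mul]
    conv_rhs => rw [h3]
    rw [mul_assoc (φ D) _ (algebraMap K A (ψ ρ)), ← Algebra.commutes (ψ ρ), mul_comm ρ, map_mul]
    simp only [mul_assoc]
  rw [← Units.val_mul w, (w * D).isUnit.mul_left_inj] at h4
  rw [Algebra.commutes, ← Units.inv_mul_cancel_left D (φ D * _), h4, mul_one, Units.inv_mul]

end Involutions

/-! ### Unitary classes of exponent two come from the base field. -/

namespace BrauerGroup

section Unitary

variable {F K : Type u} [Field F] [Field K] [Algebra F K]

/-- The unitary involution lives on an algebra only Brauer equivalent to `B`. Its conjugate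
transpose is carried over to matrices on `B`, which is why the later comparison takes place there.
-/
theorem exists_matrix_involution [Algebra.IsQuadraticExtension F K] [IsGalois F K]
    {ψ : Gal(K/F)} (hψ : ∀ φ : Gal(K/F), φ ≠ 1 → φ = ψ)
    {B : CSA.{u, u} K} (hB : cls B ∈ unitaryBr F K) :
    ∃ (n : ℕ) (_ : n ≠ 0) (t : Matrix (Fin n) (Fin n) B → Matrix (Fin n) (Fin n) B),
      (∀ X Y, t (X + Y) = t X + t Y) ∧ (∀ X Y, t (X * Y) = t Y * t X) ∧ (∀ X, t (t X) = X) ∧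
      ∀ k, t (algebraMap K _ k) = algebraMap K _ (ψ k) := by
  obtain ⟨A, hA, τ, hτ⟩ := hB
  obtain ⟨n, m, hn, hm, ⟨e⟩⟩ := cls_eq_iff.1 hA.symm
  let u : Matrix (Fin m) (Fin m) A → Matrix (Fin m) (Fin m) A := fun X => (X.map τ).transpose
  have hu : ∀ X, u X = (X.map τ).transpose := fun _ => rfl
  let τ' : A →+ A := ⟨⟨τ, by simpa using hτ.map_add 0 0⟩, hτ.map_add⟩
  have hττ' : τ = τ' := rfl
  have hadd : ∀ X Y, u (X + Y) = u X + u Y := fun X Y => by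
    ext i j
    simp [hu, hτ.map_add]
  have hmul : ∀ X Y, u (X * Y) = u Y * u X := fun X Y => by
    ext i j
    simp only [hu, Matrix.mul_apply, Matrix.transpose_apply, Matrix.map_apply]
    simp only [← hτ.map_mul]
    simp only [hττ', map_sum]
  have huu : ∀ X, u (u X) = X := fun X => by
    ext i j
    simp [hu, hτ.involutive _]
  have huK : ∀ k, u (algebraMap K _ k) = algebraMap K _ (ψ k) := fun k => by
    ext i j
    by_cases h : i = j
    · simp [hu, Matrix.algebraMap_matrix_apply, h, hτ.apply_algebraMap hψ]
    · simp [hu, Matrix.algebraMap_matrix_apply, h, Ne.symm h, hττ']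
  refine ⟨n, hn, fun X => e.symm (u (e X)), fun X Y => ?_, fun X Y => ?_, fun X => ?_,
    fun k => ?_⟩ <;> dsimp only
  · rw [map_add, hadd, map_add]
  · rw [map_mul, hmul, map_mul]
  · rw [AlgEquiv.apply_symm_apply, huu, AlgEquiv.symm_apply_apply]
  · rw [AlgEquiv.commutes, huK, AlgEquiv.commutes]

variable {M : Type u} [Field M] [Algebra K M] [FiniteDimensional K M]

/-- An automorphism that comes from an involution of the first kind and a semilinear one can be
adjusted to a given semilinear automorphism of a self-centralizing subfield. -/
theorem exists_semilinear_of_matrix_involution {ψ : Gal(K/F)} (hψψ : ∀ k, ψ (ψ k) = k)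
    {ψM : M ≃+* M} (hψM : ∀ k, ψM (algebraMap K M k) = algebraMap K M (ψ k))
    (hψMM : ∀ m, ψM (ψM m) = m) {B : CSA.{u, u} K} (ι : M →ₐ[K] B)
    {σ : B →ₗ[K] B} (hσ1 : σ 1 = 1) (hσ : ∀ x y, σ (x * y) = σ y * σ x)
    (hσσ : ∀ x, σ (σ x) = x) {n : ℕ} (hn : n ≠ 0)
    {t : Matrix (Fin n) (Fin n) B → Matrix (Fin n) (Fin n) B}
    (ht_add : ∀ X Y, t (X + Y) = t X + t Y) (ht_mul : ∀ X Y, t (X * Y) = t Y * t X)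
    (htt : ∀ X, t (t X) = X) (htK : ∀ k, t (algebraMap K _ k) = algebraMap K _ (ψ k)) :
    ∃ (φ : B ≃+* B) (w : (Matrix (Fin n) (Fin n) B)ˣ), (∀ m, φ (ι m) = ι (ψM m)) ∧
      ∀ X : Matrix (Fin n) (Fin n) B, X.map φ * w = w * ((t X).map σ).transpose := by
  have : Nonempty (Fin n) := ⟨⟨0, Nat.pos_of_ne_zero hn⟩⟩
  have hσK : ∀ k, σ (algebraMap K B k) = algebraMap K B k := fun k => by
    rw [Algebra.algebraMap_eq_smul_one, map_smul, hσ1]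
  let s : Matrix (Fin n) (Fin n) B → Matrix (Fin n) (Fin n) B := fun X => (X.map σ).transpose
  have hs_mul : ∀ X Y, s (X * Y) = s Y * s X := fun X Y => by
    ext i j
    simp [s, Matrix.mul_apply, hσ]
  have hss : ∀ X, s (s X) = X := fun X => by
    ext i j
    simp [s, hσσ]
  have hsK : ∀ k, s (algebraMap K _ k) = algebraMap K _ k := fun k => by
    ext i j
    by_cases h : i = j
    · simp [s, Matrix.algebraMap_matrix_apply, h, hσK]
    · simp [s, Matrix.algebraMap_matrix_apply, h, Ne.symm h]
  let φ₀ : Matrix (Fin n) (Fin n) B ≃+* Matrix (Fin n) (Fin n) B :=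
    { toFun := fun X => s (t X)
      invFun := fun X => t (s X)
      left_inv := fun X => by dsimp only; rw [hss, htt]
      right_inv := fun X => by dsimp only; rw [htt, hss]
      map_mul' := fun X Y => by rw [ht_mul, hs_mul]
      map_add' := fun X Y => by rw [ht_add]; ext i j; simp [s] }
  have hφ₀ : ∀ X, φ₀ X = s (t X) := fun _ => rfl
  let j : Matrix (Fin n) (Fin n) M →ₐ[K] Matrix (Fin n) (Fin n) B := ι.mapMatrix
  -- `φ₀` is `ψ`-semilinear; precomposing with `ψM` makes it `K`-linear on matrices over `M`, so
  -- Skolem–Noether applies. After conjugation by `w`, it acts there as `ψM` entrywise, preserves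
  -- matrix units, and hence comes from an automorphism `φ` of `B`.
  let f : Matrix (Fin n) (Fin n) M →ₐ[K] Matrix (Fin n) (Fin n) B :=
    { φ₀.toRingHom.comp (j.toRingHom.comp ψM.mapMatrix.toRingHom) with
      commutes' := fun k => by
        change φ₀ (j (ψM.mapMatrix (algebraMap K _ k))) = _
        have : ψM.mapMatrix (algebraMap K (Matrix (Fin n) (Fin n) M) k) =
            algebraMap K _ (ψ k) := by
          ext i j
          by_cases h : i = j <;> simp [Matrix.algebraMap_matrix_apply, h, hψM]
        rw [this, AlgHom.commutes, hφ₀, htK, hsK, hψψ] }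
  have hf : ∀ X : Matrix (Fin n) (Fin n) M, f X = φ₀ (j (X.map ψM)) := fun _ => rfl
  obtain ⟨w, hw⟩ := skolem_noether f j
  let φ₁ : Matrix (Fin n) (Fin n) B ≃+* Matrix (Fin n) (Fin n) B := φ₀.trans (innerAut w)
  have hφ₁ : ∀ X : Matrix (Fin n) (Fin n) B, φ₁ X = w * s (t X) * w.inv := fun _ => rfl
  have hφj : ∀ X : Matrix (Fin n) (Fin n) M, φ₁ (j X) = j (X.map ψM) := fun X => by
    have : (X.map ψM).map ψM = X := by
      ext
      simp [hψMM]
    rw [hw (X.map ψM), hf, this]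
    rfl
  obtain ⟨φ, hφ⟩ := exists_ringEquiv_of_matrixUnits hn φ₁ fun i k => by
    have : (Matrix.single i k 1 : Matrix (Fin n) (Fin n) B) = j (Matrix.single i k 1) := by
      ext
      simp [j, Matrix.single_apply, apply_ite ι]
    rw [this, hφj]
    congr 1
    ext
    simp [Matrix.single_apply, apply_ite ψM]
  refine ⟨φ, w, fun m => ?_, fun X => ?_⟩
  · obtain ⟨i⟩ := this
    have h1 := hφ (j (Matrix.scalar (Fin n) m))
    rw [hφj] at h1
    simpa [j] using (congr($h1 i i)).symm
  · rw [← hφ, hφ₁, mul_assoc, w.inv_val, mul_one]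

/-- A unitary class of exponent two split by a multiquadratic extension comes from a class of
exponent two of the base field. -/
theorem exists_res_eq_of_mem_relUnitaryBr [Algebra.IsQuadraticExtension F K] [IsGalois F K]
    [IsGalois K M] (h2 : (2 : F) ≠ 0)
    (hgal : ∀ g : Gal(M/K), ∀ m, g (g m) = m)
    {ψ : Gal(K/F)} (hψ1 : ψ ≠ 1) (hψ : ∀ φ : Gal(K/F), φ ≠ 1 → φ = ψ)
    {ψM : M ≃+* M} (hψM : ∀ k, ψM (algebraMap K M k) = algebraMap K M (ψ k))
    (hψMM : ∀ m, ψM (ψM m) = m) {y : BrauerGroup.{u, u} K} (hy : y ∈ relUnitaryBr F K M)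
    (hy2 : y ^ 2 = 1) : ∃ x : BrauerGroup.{u, u} F, res F K x = y ∧ x ^ 2 = 1 := by
  have hψψ := gal_gal_apply_of_unique hψ1 hψ
  obtain ⟨B, ι, rfl, -, hι⟩ := exists_selfCentralizing hy.1
  obtain ⟨e⟩ := nonempty_algEquiv_op hy2
  obtain ⟨σ, hσ1, hσ, hσι, hσσ⟩ := exists_involution_of_algEquiv_op hgal ι hι e
  obtain ⟨n, hn, t, ht_add, ht_mul, htt, htK⟩ := exists_matrix_involution hψ hy.2
  obtain ⟨φ, w, hφι, hφt⟩ := exists_semilinear_of_matrix_involution hψψ hψM hψMM ι hσ1 hσ hσσ hn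
    ht_add ht_mul htt htK
  have hιinj : Function.Injective ι := ι.toRingHom.injective
  have hφK : ∀ k, φ (algebraMap K B k) = algebraMap K B (ψ k) := fun k => by
    rw [← AlgHom.commutes ι, hφι, hψM, AlgHom.commutes]
  have hσK : ∀ k, σ (algebraMap K B k) = algebraMap K B k := fun k => by
    rw [Algebra.algebraMap_eq_smul_one, map_smul, hσ1]
  obtain ⟨m, hm0, hmm, hm⟩ : ∃ m : M, m ≠ 0 ∧ ψM m * m = 1 ∧
      ∀ x, ι m * φ (σ (φ x)) = σ x * ι m := by
    -- `φσφσ` is `K`-linear and trivial on `M`, hence conjugation by some `m` in `M`; this `m`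
    -- measures the failure of `φσφ = σ`.
    let f : B →ₐ[K] B :=
      { toFun := fun x => φ (σ (φ (σ x)))
        map_one' := by simp [hσ1]
        map_mul' := fun x y => by simp [hσ]
        map_zero' := by simp
        map_add' := fun x y => by simp
        commutes' := fun k => by rw [hσK, hφK, hσK, hφK, hψψ] }
    have hf : ∀ x, f x = φ (σ (φ (σ x))) := fun _ => rfl
    obtain ⟨v, hv⟩ := skolem_noether f (AlgHom.id K B)
    have hv' : ∀ x, v * φ (σ (φ (σ x))) = x * v := fun x => by
      have : x = v * f x * ↑v⁻¹ := hv x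
      conv_rhs => rw [this]
      rw [mul_assoc, Units.inv_mul, mul_one, hf]
    obtain ⟨m, hm⟩ := hι v fun m => by rw [← hv', hσι, hφι, hσι, hφι, hψMM]
    have hm0 : m ≠ 0 := by
      rintro rfl
      rw [map_zero] at hm
      exact v.ne_zero hm
    rw [hm] at hv'
    have hv2 : ∀ x, ι m * φ (σ (φ x)) = σ x * ι m := fun x => by rw [← hv', hσσ]
    let j : Matrix (Fin n) (Fin n) M →ₐ[K] Matrix (Fin n) (Fin n) B := ι.mapMatrix
    obtain ⟨D, hD⟩ : IsUnit (j (Matrix.scalar (Fin n) m)) :=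
      ((IsUnit.mk0 m hm0).map (Matrix.scalar (Fin n))).map j
    have hD' : (D : Matrix (Fin n) (Fin n) B) = Matrix.diagonal fun _ => ι m := by
      rw [hD]
      ext i k
      by_cases h : i = k <;> simp [j, h]
    let s : Matrix (Fin n) (Fin n) B →ₗ[K] Matrix (Fin n) (Fin n) B :=
      { toFun := fun X => (X.map σ).transpose
        map_add' := fun X Y => by ext; simp
        map_smul' := fun k X => by ext; simp }
    have hs : ∀ X : Matrix (Fin n) (Fin n) B, s X = (X.map σ).transpose := fun _ => rfl
    -- Here the involutivity of `t` enters: it shows that `ψM m * m` is the inverse of a norm from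
    -- `K`, so scaling `m` by `ρ` gives norm one.
    obtain ⟨ρ, hρ⟩ := exists_norm_mul_eq_one (ψ := ψ) (σ := s)
      (fun X Y => by ext i j; simp [hs, Matrix.mul_apply, hσ])
      (fun X => by ext i j; simp [hs, hσσ]) htt φ.mapMatrix
      (fun k => by
        ext i j
        by_cases h : i = j <;> simp [Matrix.algebraMap_matrix_apply, h, hφK]) w D hφt
      (fun X => by
        rw [hD']
        ext i j
        simp [hs, hv2])
      (by
        rw [hD', hs]
        ext i j
        by_cases h : i = j
        · simp [h, hσι]
        · simp [h, Ne.symm h])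
    have h3 : algebraMap K M (ρ * ψ ρ) * ψM m * m = 1 := by
      apply hιinj
      have h4 := congr($hρ ⟨0, Nat.pos_of_ne_zero hn⟩ ⟨0, Nat.pos_of_ne_zero hn⟩)
      rw [hD'] at h4
      simpa [Matrix.algebraMap_eq_diagonal, hφι] using h4
    have h5 : ψM (algebraMap K M ρ * m) * (algebraMap K M ρ * m) = 1 := by
      rw [← h3, map_mul, map_mul, hψM]
      ring
    refine ⟨algebraMap K M ρ * m, right_ne_zero_of_mul_eq_one h5, h5, fun x => ?_⟩
    rw [map_mul, AlgHom.commutes, mul_assoc, hv2, ← mul_assoc, Algebra.commutes, mul_assoc]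
  -- Hilbert 90 for `ψM`; when `1 + ψM m` vanishes, `m = -1` and an anti-invariant element of `K`
  -- serves.
  obtain ⟨h, hh0, hh⟩ : ∃ h : M, h ≠ 0 ∧ m * h = ψM h := by
    by_cases h : 1 + ψM m = 0
    · obtain ⟨α, hα0, hα⟩ := exists_ne_zero_gal_eq_neg hψ1 hψ
      refine ⟨algebraMap K M α, (map_ne_zero _).2 hα0, ?_⟩
      have : m = -1 := by
        have := congr_arg ψM h
        rw [map_add, map_one, hψMM, map_zero] at this
        linear_combination this
      rw [hψM, hα, this, map_neg]
      ring
    · refine ⟨1 + ψM m, h, ?_⟩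
      rw [map_add, map_one, hψMM]
      linear_combination hmm
  have hhh : ι h * ι h⁻¹ = 1 := by rw [← map_mul, mul_inv_cancel₀ hh0, map_one]
  have hhh' : ι h⁻¹ * ι h = 1 := by rw [← map_mul, inv_mul_cancel₀ hh0, map_one]
  -- Conjugating `φ` by `h⁻¹` keeps its action on `M` and cancels `m`, so the new automorphism
  -- satisfies `φσφ = σ`.
  refine exists_descent_of_semilinear h2 hψ1 hψ hψM hψMM ι hι hσ1 hσ hσι
    (φ.trans (innerAut ⟨ι h⁻¹, ι h, hhh', hhh⟩)) (fun x => ?_) fun x => ?_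
  · change ι h⁻¹ * φ (ι x) * ι h = _
    rw [hφι, mul_assoc, ← map_mul, mul_comm _ h, map_mul, ← mul_assoc, hhh', one_mul]
  · change ι h⁻¹ * φ (σ (ι h⁻¹ * φ x * ι h)) * ι h = _
    have h3 : ι (m * h)⁻¹ * ι h = ι m⁻¹ := by
      rw [← map_mul]
      congr 1
      field_simp
    rw [hσ, hσ, hσι, hσι, map_mul, map_mul, hφι, hφι, map_inv₀ ψM, ← hh, mul_comm m h, map_mul,
      ← mul_assoc, ← mul_assoc, ← mul_assoc (ι h⁻¹), hhh', one_mul, hm, mul_comm h m, mul_assoc, h3,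
      mul_assoc, ← map_mul, mul_inv_cancel₀ hm0, map_one, mul_one]

end Unitary
end BrauerGroup

/-! ### The `Dec` groups under restriction. -/

namespace BrauerGroup

theorem Dec_le_relBr2 {K M : Type u} [Field K] [Field M] [Algebra K M] [IsGalois K M]
    [FiniteDimensional K M] (h2 : (2 : K) ≠ 0) (hgal : ∀ g : Gal(M/K), ∀ m, g (g m) = m) :
    Dec K M ≤ relBr2 K M := by
  rw [Dec, Subgroup.closure_le]
  intro x hx
  rcases eq_one_or_eq_quat_of_mem_cyclicClasses h2 hgal hx with rfl | ⟨d, r, hd, hr, δ, hδ, -, rfl⟩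
  · exact one_mem _
  · exact ⟨quat_mem_relBr h2 hd hr hδ, quat_sq h2 hd hr⟩

section Tower

variable {F K M : Type u} [Field F] [Field K] [Field M] [Algebra F K] [Algebra K M] [Algebra F M]
  [IsScalarTower F K M]

/-- Restricting a quaternion class keeps its second slot in `F`, while its first slot is still a
square in `M`. -/
theorem res_mem_DecUnitary [IsGalois F M] [FiniteDimensional F M] (h2 : (2 : F) ≠ 0)
    (hgal : ∀ g : Gal(M/F), ∀ m, g (g m) = m) {x : BrauerGroup.{u, u} F} (hx : x ∈ Dec F M) :
    res F K x ∈ DecUnitary F K M := by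
  have h : Dec F M ≤ (DecUnitary F K M).comap (res F K) := by
    rw [Dec, Subgroup.closure_le]
    intro x hx
    rcases eq_one_or_eq_quat_of_mem_cyclicClasses h2 hgal hx with
      rfl | ⟨d, r, hd, hr, δ, hδ, -, rfl⟩
    · exact one_mem _
    · change res F K _ ∈ DecUnitary F K M
      rw [res_quat h2 (two_ne_zero_of_algebra h2)]
      refine quat_mem_closure_cyclicClasses _ _ _ ⟨r, rfl⟩ (δ := δ) ?_
      rw [hδ, IsScalarTower.algebraMap_apply F K M]
  exact h hx

/-- Over a biquadratic extension `M/K` defined over `F`, the group `Dec(M/K;F)` comes from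
`Dec(M/F)`. -/
theorem DecUnitary_le_map_Dec (h2 : (2 : F) ≠ 0) {s : Fin 2 → M} {d : Fin 2 → F}
    (hd : ∀ i, d i ≠ 0) (hs : ∀ i, s i ^ 2 = algebraMap F M (d i))
    (htop : IntermediateField.adjoin K (Set.range s) = ⊤) (hdeg : Module.finrank K M = 2 ^ 2) :
    DecUnitary F K M ≤ (Dec F M).map (res F K) := by
  have hF : FiniteDimensional K M := .of_finrank_pos (by omega)
  have h2K : (2 : K) ≠ 0 := two_ne_zero_of_algebra h2
  have hd' : ∀ i, algebraMap F K (d i) ≠ 0 := fun i => (map_ne_zero _).2 (hd i)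
  have hs' : ∀ i, s i ^ 2 = algebraMap K M (algebraMap F K (d i)) := fun i => by
    rw [hs, IsScalarTower.algebraMap_apply F K M]
  have hG := isGalois_of_adjoin_sqrt h2K hd' hs' htop
  rw [DecUnitary, Subgroup.closure_le]
  intro x hx
  rcases eq_one_or_eq_quat_of_mem_cyclicClasses h2K (gal_gal_apply hs' htop) hx with
    rfl | ⟨e, _, he, hr, δ, hδ, ⟨r, rfl⟩, rfl⟩
  · exact one_mem _
  -- Up to a square in `K`, the first slot is a product of the `d i`, so both slots can be taken in
  -- `F`.
  · obtain ⟨k, i, j, rfl⟩ := exists_eq_sq_mul_of_biquadratic h2K hd' hs' htop hdeg hδ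
    have hk : k ≠ 0 := by
      rintro rfl
      simp at he
    have hr' : r ≠ 0 := (map_ne_zero _).1 hr
    have hd0 : d 0 ^ i * d 1 ^ j ≠ 0 := mul_ne_zero (pow_ne_zero i (hd 0)) (pow_ne_zero j (hd 1))
    refine ⟨quat h2 hd0 hr', quat_mem_closure_cyclicClasses h2 _ _ trivial
      (δ := s 0 ^ i * s 1 ^ j) ?_, ?_⟩
    · rw [map_mul, map_pow, map_pow, ← hs, ← hs]
      ring
    · rw [res_quat h2 h2K, quat_mul_sq h2K (right_ne_zero_of_mul he) hr hk]
      exact quat_congr h2K _ _ (by rw [map_mul, map_pow, map_pow]) rfl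

end Tower
end BrauerGroup

/-! ### The exact sequence. -/

open BrauerGroup

theorem mainTheorem7 {F K M : Type u} [Field F] [Field K] [Field M]
    [Algebra F K] [Algebra K M] [Algebra F M] [IsScalarTower F K M]
    [Algebra.IsQuadraticExtension F K] [IsGalois F K]
    (hchar : ringChar F ≠ 2)
    (a b c : F) (ha : a ≠ 0) (hb : b ≠ 0) (hc : c ≠ 0)
    (α : K) (β γ : M)
    (hα : α ^ 2 = algebraMap F K a) (hβ : β ^ 2 = algebraMap F M b)
    (hγ : γ ^ 2 = algebraMap F M c)
    (hK : IntermediateField.adjoin F {α} = ⊤)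
    (hM : IntermediateField.adjoin F {algebraMap K M α, β, γ} = ⊤)
    (hdeg : Module.finrank F M = 8) :
    -- the three `Dec` groups are subgroups of the groups they are divided out of
    BrauerGroup.Dec F M ≤ BrauerGroup.relBr2 F M ∧
    BrauerGroup.DecUnitary F K M ≤ BrauerGroup.relUnitaryBr F K M ∧
    BrauerGroup.Dec K M ≤ BrauerGroup.relBr K M ∧
    -- `f` is induced by restriction from `F` to `K`, and `g` by the inclusion
    ∃ (hres : ∀ x ∈ BrauerGroup.relBr2 F M,
          BrauerGroup.res F K x ∈ BrauerGroup.relUnitaryBr F K M)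
      (hincl : ∀ y ∈ BrauerGroup.relUnitaryBr F K M, y ∈ BrauerGroup.relBr K M)
      (f : (BrauerGroup.relBr2 F M ⧸
            (BrauerGroup.Dec F M).subgroupOf (BrauerGroup.relBr2 F M)) →*
          (BrauerGroup.relUnitaryBr F K M ⧸
            (BrauerGroup.DecUnitary F K M).subgroupOf (BrauerGroup.relUnitaryBr F K M)))
      (g : (BrauerGroup.relUnitaryBr F K M ⧸
            (BrauerGroup.DecUnitary F K M).subgroupOf (BrauerGroup.relUnitaryBr F K M)) →*
          (BrauerGroup.relBr K M ⧸
            (BrauerGroup.Dec K M).subgroupOf (BrauerGroup.relBr K M))),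
      (∀ x : BrauerGroup.relBr2 F M,
        f (QuotientGroup.mk x) =
          QuotientGroup.mk ⟨BrauerGroup.res F K (x : BrauerGroup.{u, u} F), hres x x.2⟩) ∧
      (∀ y : BrauerGroup.relUnitaryBr F K M,
        g (QuotientGroup.mk y) =
          QuotientGroup.mk ⟨(y : BrauerGroup.{u, u} K), hincl y y.2⟩) ∧
      -- exactness of `1 → · → · → ·`
      Function.Injective f ∧ f.range = g.ker := by
  have h2 : (2 : F) ≠ 0 := Ring.two_ne_zero hchar
  have h2K : (2 : K) ≠ 0 := two_ne_zero_of_algebra h2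
  have hdegK : Module.finrank F K = 2 := Algebra.IsQuadraticExtension.finrank_eq_two F K
  have hdegM : Module.finrank K M = 2 ^ 2 := by
    have := Module.finrank_mul_finrank F K M
    rw [hdegK, hdeg] at this
    omega
  have hFM : FiniteDimensional F M := .of_finrank_pos (by omega)
  have hKM : FiniteDimensional K M := .of_finrank_pos (by omega)
  have hαM : algebraMap K M α ^ 2 = algebraMap F M a := by
    rw [← map_pow, hα, ← IsScalarTower.algebraMap_apply]
  let s : Fin 3 → M := ![algebraMap K M α, β, γ]
  let d : Fin 3 → F := ![a, b, c]
  have hs : ∀ i, s i ^ 2 = algebraMap F M (d i) := by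
    intro i
    fin_cases i
    exacts [hαM, hβ, hγ]
  have hd : ∀ i, d i ≠ 0 := by
    intro i
    fin_cases i
    exacts [ha, hb, hc]
  have hrange : Set.range s = {algebraMap K M α, β, γ} := by
    ext x
    rw [Set.mem_range, Fin.exists_fin_succ, Fin.exists_fin_two]
    simp [s, eq_comm]
  have htop : IntermediateField.adjoin F (Set.range s) = ⊤ := by rw [hrange, hM]
  have hGF := isGalois_of_adjoin_sqrt h2 hd hs htop
  have hgalF := gal_gal_apply hs htop
  let t : Fin 2 → M := ![β, γ]
  let e : Fin 2 → F := ![b, c]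
  have ht : ∀ i, t i ^ 2 = algebraMap F M (e i) := by
    intro i
    fin_cases i
    exacts [hβ, hγ]
  have he : ∀ i, e i ≠ 0 := by
    intro i
    fin_cases i
    exacts [hb, hc]
  have htK : ∀ i, t i ^ 2 = algebraMap K M (algebraMap F K (e i)) := fun i => by
    rw [ht, IsScalarTower.algebraMap_apply F K M]
  have heK : ∀ i, algebraMap F K (e i) ≠ 0 := fun i => (map_ne_zero _).2 (he i)
  have htopK : IntermediateField.adjoin K (Set.range t) = ⊤ := by
    have h : IntermediateField.adjoin F {algebraMap K M α, β, γ} ≤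
        (IntermediateField.adjoin K (Set.range t)).restrictScalars F := by
      rw [IntermediateField.adjoin_le_iff]
      rintro x (rfl | rfl | rfl)
      · exact (IntermediateField.adjoin K (Set.range t)).algebraMap_mem α
      · exact IntermediateField.subset_adjoin K _ ⟨0, rfl⟩
      · exact IntermediateField.subset_adjoin K _ ⟨1, rfl⟩
    rw [hM] at h
    exact eq_top_iff.2 fun x _ => h trivial
  have hGK := isGalois_of_adjoin_sqrt h2K heK htK htopK
  have hgalK := gal_gal_apply htK htopK
  have hDecF : Dec F M ≤ relBr2 F M := Dec_le_relBr2 h2 hgalF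
  have hDecK : Dec K M ≤ relBr2 K M := Dec_le_relBr2 h2K hgalK
  have hDecU := DecUnitary_le_map_Dec h2 he ht htopK hdegM
  have hres : ∀ x ∈ relBr2 F M, res F K x ∈ relUnitaryBr F K M := fun x hx =>
    ⟨(res_res (M := M) x).trans hx.1, res_mem_unitaryBr hgalF hx⟩
  have hincl : ∀ y ∈ relUnitaryBr F K M, y ∈ relBr K M := fun y hy => hy.1
  have hDecUK : ∀ y ∈ DecUnitary F K M, y ∈ Dec K M := fun y hy =>
    Subgroup.closure_mono (by
      rintro z ⟨L, σ, b, A, -, h⟩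
      exact ⟨L, σ, b, A, trivial, h⟩) hy
  let resHom : relBr2 F M →* relUnitaryBr F K M :=
    { toFun := fun x => ⟨res F K x, hres x x.2⟩
      map_one' := Subtype.ext (map_one (res F K))
      map_mul' := fun x y => Subtype.ext (map_mul (res F K) (x : BrauerGroup F) y) }
  refine ⟨hDecF, fun y hy => ?_, hDecK.trans inf_le_left, hres, hincl,
    QuotientGroup.map _ _ resHom fun x hx => res_mem_DecUnitary h2 hgalF hx,
    QuotientGroup.map _ _ (Subgroup.inclusion hincl) fun y hy => hDecUK y hy,
    fun _ => rfl, fun _ => rfl, ?_, ?_⟩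
  -- Unitarity is obtained from the base field: the class is a restriction from `Dec(M/F)`, and
  -- restrictions of exponent-two classes split by `M` are unitary.
  · obtain ⟨x, hx, rfl⟩ := hDecU hy
    exact hres x (hDecF hx)
  · rw [injective_iff_map_eq_one]
    intro q hq
    induction q using QuotientGroup.induction_on with | H x => ?_
    replace hq : res F K x ∈ DecUnitary F K M := (QuotientGroup.eq_one_iff (resHom x)).1 hq
    rw [QuotientGroup.eq_one_iff]
    obtain ⟨x', hx', hxx'⟩ := hDecU hq
    obtain ⟨g, hg, hgg, hgfix⟩ := exists_gal_neg h2 hdegK ha hα hK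
    -- `x` and `x'` have the same restriction, so their quotient is split by `K` and is a quaternion
    -- class `(a, r)`.
    obtain ⟨r, hr, h3⟩ := exists_eq_quat_of_mem_relBr hdegK h2 ha hα g hg hgg hgfix
      (x := x * x'⁻¹) (by
        rw [mem_relBr_iff, map_mul, map_inv, hxx']
        exact mul_inv_cancel _)
    have h4 : (x : BrauerGroup.{u, u} F) = quat h2 ha hr * x' := by
      rw [← h3, inv_mul_cancel_right]
    change (x : BrauerGroup.{u, u} F) ∈ Dec F M
    rw [h4]
    exact mul_mem (quat_mem_closure_cyclicClasses h2 _ _ trivial hαM) hx'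
  · ext q
    induction q using QuotientGroup.induction_on with | H y => ?_
    refine Iff.trans ?_
      (MonoidHom.mem_ker.trans (QuotientGroup.eq_one_iff (Subgroup.inclusion hincl y))).symm
    change _ ↔ (y : BrauerGroup.{u, u} K) ∈ Dec K M
    constructor
    · rintro ⟨p, hp⟩
      induction p using QuotientGroup.induction_on with | H x => ?_
      replace hp : (res F K x)⁻¹ * y ∈ DecUnitary F K M :=
        QuotientGroup.eq (a := resHom x) (b := y) |>.1 hp
      -- The restriction has exponent two, so the biquadratic theorem applies.
      have h3 : res F K x ∈ Dec K M :=
        relBr2_le_Dec_of_biquadratic h2K t _ heK htK htopK hdegM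
          ⟨(hres x x.2).1, by
            change res F K x ^ 2 = 1
            rw [← map_pow, show (x : BrauerGroup.{u, u} F) ^ 2 = 1 from x.2.2, map_one]⟩
      have h4 := mul_mem h3 (hDecUK _ hp)
      rwa [mul_inv_cancel_left] at h4
    · intro hy
      obtain ⟨ψ, hψ1, hψ⟩ := exists_gal_ne_one (F := F) (K := K)
      -- Negating only the square root of `a` gives a lift of `ψ` to `M` of order two, as the
      -- descent requires.
      obtain ⟨g, hg⟩ := exists_gal_of_signs h2 hd hs htop hdeg ![true, false, false]
      have hgα : g (algebraMap K M α) = -algebraMap K M α := by simpa [s] using hg 0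
      have hψα : ψ α = -α := by
        refine (gal_apply_eq_or_eq_neg ψ hα).resolve_left fun h => hψ1 ?_
        refine gal_ext_of_adjoin (s := fun _ : Fin 1 => α) (by rw [Set.range_const, hK]) fun _ => h
      have hgψ : ∀ k, g (algebraMap K M k) = algebraMap K M (ψ k) := by
        intro k
        have hk : k ∈ IntermediateField.adjoin F {α} := by rw [hK]; trivial
        induction hk using IntermediateField.adjoin_induction with
        | mem x hx => rw [Set.mem_singleton_iff.1 hx, hgα, hψα, map_neg]
        | algebraMap x =>
          rw [AlgEquiv.commutes, ← IsScalarTower.algebraMap_apply, AlgEquiv.commutes]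
        | add x y _ _ hx hy => simp only [map_add, hx, hy]
        | inv x _ hx => simp only [map_inv₀, hx]
        | mul x y _ _ hx hy => simp only [map_mul, hx, hy]
      -- Membership of `y` in `Dec(M/K)` enters only through `y² = 1`.
      obtain ⟨x, hx, hx2⟩ := exists_res_eq_of_mem_relUnitaryBr h2 hgalK hψ1 hψ
        (ψM := g.toRingEquiv) hgψ (hgalF g) y.2 (hDecK hy).2
      have hxM : x ∈ relBr2 F M := ⟨by
        change x ∈ relBr F M
        rw [mem_relBr_iff, ← res_res (K := K), hx]
        exact y.2.1, hx2⟩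
      exact ⟨QuotientGroup.mk ⟨x, hxM⟩,
        congr_arg QuotientGroup.mk (Subtype.ext hx : resHom ⟨x, hxM⟩ = y)⟩
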